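/- Let $N\ge 2$ and $n_1,\dots,n_N\in\mathbb{N}$, $n=\sum_i n_i$. Consider an $N$-player game in which player $i$ chooses $x_i\in\Omega_i=\mathbb{R}^{n_i}$ to minimize $J_i(x_i,x_{-i})$, where every $J_i:\mathbb{R}^n\to\mathbb{R}$ is $C^1$ and, for every $x_{-i}$, convex and radially unbounded in $x_i$. Let $F(x)=\mathrm{col}(\nabla_{x_i}J_i(x))_{i}$ be the pseudo-gradient and, for $\mathbf{x}=\mathrm{col}(\mathbf{x}^1,\dots,\mathbf{x}^N)\in\mathbb{R}^{Nn}$ with $\mathbf{x}^i\in\mathbb{R}^n$, let $\mathbf{F}(\mathbf{x})=\mathrm{col}(\nabla_{x_i}J_i(\mathbf{x}^i))_{i}$ be the extended pseudo-gradient. Let $\mathcal{R}^T:\mathbb{R}^n\to\mathbb{R}^{Nn}$ send $v$ to the vector $\mathbf{x}$ with $\mathbf{x}^i_i=v_i$ and $\mathbf{x}^i_j=0$ for $j\ne i$. Let $L=\mathrm{Deg}-W$ be the weighted Laplacian of a connected undirected graph on $\{1,\dots,N\}$ with symmetric weights $w_{ij}$, positive on edges and zero otherwise, let $\lambda_2(L)$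 be its second smallest eigenvalue (counted with multiplicity), and put $\mathbf{L}=L\otimes I_n$. Assume that, for constants $L_F\ge0$, $R>0$, $\mu\ge 0$ and all $x,y\in\mathbb{R}^n$ (Euclidean norm), $\|F(x)-F(y)\|\le L_F\|x-y\|$ ($L_F$-Lipschitz), $\|x-y\|\le R\|F(x)-F(y)\|$ ($R$-inverse Lipschitz), and $\langle F(x)-F(y),x-y\rangle\ge-\mu\|x-y\|^2$ ($\mu$-hypomonotone). Let $0<d<1$ and $\beta\in\left(\frac{\mu}{N},\frac{1}{\mu NR^2}\right)$ (that is, $\beta\in(0,\infty)$ if $\mu=0$). With $\lambda=\frac1{\beta N}$ put $$L_{\mathcal J}=\sqrt{\frac{R^2}{R^2+\lambda^2-2\lambda\mu R^2}},\qquad \kappa_{\mathcal J}=\begin{cases}\dfrac{R^2(1-\mu\lambda)}{R^2+\lambda^2-2\mu\lambda R^2}, & R\ge\lambda,\\[2mm] \dfrac{R^2(1+\lambda/R)}{R^2+\lambda^2+2\lambda R}, & \lambda\ge R,\end{cases}$$ and let $$0<\alpha<\frac{4d(1-d)\left(\beta-\frac{\mu}{N}\right)(1-\kappa_{\mathcal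 J})}{\left((1-d)+d(L_{\mathcal J}+L_{\mathcal J}^2)\right)^2}.$$ Let $$\Phi=\begin{bmatrix}(1-d)\alpha(1-\kappa_{\mathcal J}) & -\frac{\alpha+\alpha(L_{\mathcal J}^2+L_{\mathcal J}-1)d}{2}\\ -\frac{\alpha+\alpha(L_{\mathcal J}^2+L_{\mathcal J}-1)d}{2} & d\left(\beta-\frac{\mu}{N}\right)\end{bmatrix},$$ $$\eta_1=\alpha(1-d)(1-\kappa_{\mathcal J})\left(1+\tfrac{d}{\sqrt N}\right)^2+d\left(\beta-\tfrac{\mu}{N}\right)L_{\mathcal J}^2,\qquad \eta_2=\alpha\left(1+[L_{\mathcal J}^2+L_{\mathcal J}-1]d\right)\left(1+\tfrac{d}{\sqrt N}\right)L_{\mathcal J},$$ and let $c$ satisfy $$c\,\lambda_2(L)>\frac{\eta_1+\eta_2}{4\det\Phi}L_F^2+L_F.$$ Then the dynamics $$\dot{\mathbf r}=\alpha(\mathbf x-\mathbf r),\qquad \dot{\mathbf x}=-\mathcal{R}^T\mathbf F(\mathbf x)-\beta(\mathbf x-\mathbf r)-c\,\mathbf L\mathbf x$$ converge globally to a Nash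 equilibrium: there is a Nash equilibrium $x^*$ of the game such that for every initial condition $(\mathbf x(0),\mathbf r(0))\in\mathbb{R}^{Nn}\times\mathbb{R}^{Nn}$ a solution on $[0,\infty)$ exists, and every such solution satisfies $\mathbf x(t)\to\mathbf 1_N\otimes x^*$ and $\mathbf r(t)\to\mathbf 1_N\otimes x^*$ as $t\to\infty$. -/

import Mathlib

open scoped NNReal Topology
open Filter

noncomputable section

namespace HeavyAnchor

/-! ### Games -/

/-- Action profiles `x = (x_1, …, x_N)` with `x_i ∈ ℝ^{n_i}`, carrying the Euclidean norm of
`ℝ^n`, `n = n_1 + ⋯ + n_N`. -/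
abbrev Profile {N : ℕ} (n : Fin N → ℕ) : Type :=
  PiLp 2 (fun i : Fin N => EuclideanSpace ℝ (Fin (n i)))

/-- The augmented space `ℝ^{Nn}`: stacked vectors `col(𝐱^1, …, 𝐱^N)`, where `𝐱^i ∈ ℝ^n` is
agent `i`'s estimate of the whole action profile. -/
abbrev Aug {N : ℕ} (n : Fin N → ℕ) : Type :=
  PiLp 2 (fun _ : Fin N => Profile n)

variable {N : ℕ} {n : Fin N → ℕ}

/-- The profile `(y, x_{-i})`. -/
def replaceAction (x : Profile n) (i : Fin N) (y : EuclideanSpace ℝ (Fin (n i))) : Profile n :=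
  WithLp.toLp 2 (Function.update (fun j => x j) i y)

/-- `x` is a Nash equilibrium of the game with costs `J_i` and action sets `Ω_i = ℝ^{n_i}`. -/
def IsNashEquilibrium (J : Fin N → Profile n → ℝ) (x : Profile n) : Prop :=
  ∀ (i : Fin N) (y : EuclideanSpace ℝ (Fin (n i))), J i x ≤ J i (replaceAction x i y)

/-- Every `J_i` is `C¹`, and convex and radially unbounded in `x_i` for every `x_{-i}`. -/
structure RegularCosts (J : Fin N → Profile n → ℝ) : Prop where
  contDiff : ∀ i, ContDiff ℝ 1 (J i)
  convex : ∀ (i : Fin N) (x : Profile n),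
    ConvexOn ℝ Set.univ (fun y : EuclideanSpace ℝ (Fin (n i)) => J i (replaceAction x i y))
  radiallyUnbounded : ∀ (i : Fin N) (x : Profile n),
    Tendsto (fun y : EuclideanSpace ℝ (Fin (n i)) => J i (replaceAction x i y))
      (Bornology.cobounded (EuclideanSpace ℝ (Fin (n i)))) atTop

/-- The partial gradient `∇_{x_i} J_i (x)`. -/
def partialGradient (J : Fin N → Profile n → ℝ) (i : Fin N) (x : Profile n) :
    EuclideanSpace ℝ (Fin (n i)) :=
  gradient (fun y : EuclideanSpace ℝ (Fin (n i)) => J i (replaceAction x i y)) (x i)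

/-- The pseudo-gradient `F(x) = col(∇_{x_i} J_i(x))`. -/
def pseudoGradient (J : Fin N → Profile n → ℝ) (x : Profile n) : Profile n :=
  WithLp.toLp 2 (fun i => partialGradient J i x)

/-- The extended pseudo-gradient `𝐅(𝐱) = col(∇_{x_i} J_i(𝐱^i))`. -/
def extPseudoGradient (J : Fin N → Profile n → ℝ) (X : Aug n) : Profile n :=
  WithLp.toLp 2 (fun i => partialGradient J i (X i))

/-- `T` is `μ`-hypomonotone. -/
def Hypomonotone {E : Type*} [NormedAddCommGroup E] [InnerProductSpace ℝ E]
    (μ : ℝ) (T : E → E) : Prop :=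
  ∀ x y : E, -μ * ‖x - y‖ ^ 2 ≤ inner ℝ (T x - T y) (x - y)

/-! ### The communication graph -/

/-- An undirected graph on the agents with symmetric weights `w_ij`, positive exactly on the
edges. -/
structure WeightedGraph (N : ℕ) where
  graph : SimpleGraph (Fin N)
  weight : Matrix (Fin N) (Fin N) ℝ
  weight_symm : ∀ i j, weight i j = weight j i
  weight_pos : ∀ i j, graph.Adj i j → 0 < weight i j
  weight_zero : ∀ i j, ¬ graph.Adj i j → weight i j = 0

namespace WeightedGraph

/-- The weighted Laplacian `L = Deg - W`. -/
def laplacian (G : WeightedGraph N) : Matrix (Fin N) (Fin N) ℝ :=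
  Matrix.diagonal (fun i => ∑ j, G.weight i j) - G.weight

theorem laplacian_isHermitian (G : WeightedGraph N) : G.laplacian.IsHermitian := by
  refine (Matrix.isHermitian_diagonal _).sub ?_
  ext i j
  simp [Matrix.conjTranspose_apply, G.weight_symm j i]

/-- The second smallest eigenvalue `λ₂(L)`, counted with multiplicity. Mathlib lists the
eigenvalues of a Hermitian matrix in decreasing order, so it has index `N - 2`. -/
def lambda2 (G : WeightedGraph N) (hN : 2 ≤ N) : ℝ :=
  G.laplacian_isHermitian.eigenvalues₀
    ⟨N - 2, by rw [Fintype.card_fin]; omega⟩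

end WeightedGraph

/-! ### The dynamics -/

/-- `𝟏_N ⊗ x`. -/
def consensus (x : Profile n) : Aug n :=
  WithLp.toLp 2 (fun _ => x)

/-- `ℛᵀ v`: the stacked vector with `𝐱^i_i = v_i` and `𝐱^i_j = 0` for `j ≠ i`. -/
def embedOwn (v : Profile n) : Aug n :=
  WithLp.toLp 2 (fun i => WithLp.toLp 2 (Pi.single i (v i)))

/-- `(A ⊗ I_n) 𝐱`. -/
def kronApply (A : Matrix (Fin N) (Fin N) ℝ) (X : Aug n) : Aug n :=
  WithLp.toLp 2 (fun i => ∑ j, A i j • X j)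

/-- `(𝐱, 𝐫)` solves, on `[0, ∞)`,
`𝐫' = α (𝐱 - 𝐫)`, `𝐱' = -ℛᵀ 𝐅(𝐱) - β (𝐱 - 𝐫) - c (L ⊗ I_n) 𝐱`. -/
def IsSolution (J : Fin N → Profile n → ℝ) (G : WeightedGraph N) (α β c : ℝ)
    (X r : ℝ → Aug n) : Prop :=
  ∀ t : ℝ, 0 ≤ t →
    HasDerivWithinAt r (α • (X t - r t)) (Set.Ici 0) t ∧
    HasDerivWithinAt X
      (-embedOwn (extPseudoGradient J (X t)) - β • (X t - r t)
        - c • kronApply G.laplacian (X t)) (Set.Ici 0) t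

/-! ### The constants -/

/-- `L_𝒥`, as a function of `R`, `μ` and `λ = l`. -/
def lipJ (R μ l : ℝ) : ℝ :=
  Real.sqrt (R ^ 2 / (R ^ 2 + l ^ 2 - 2 * l * μ * R ^ 2))

/-- `κ_𝒥`, as a function of `R`, `μ` and `λ = l`. -/
def kappaJ (R μ l : ℝ) : ℝ :=
  if l ≤ R then R ^ 2 * (1 - μ * l) / (R ^ 2 + l ^ 2 - 2 * μ * l * R ^ 2)
  else R ^ 2 * (1 + l / R) / (R ^ 2 + l ^ 2 + 2 * l * R)

/-- The matrix `Φ`, with `LJ = L_𝒥`, `κ = κ_𝒥` and `m = μ / N`. -/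
def Phi (d α β m LJ κ : ℝ) : Matrix (Fin 2) (Fin 2) ℝ :=
  !![(1 - d) * α * (1 - κ), -((α + α * (LJ ^ 2 + LJ - 1) * d) / 2);
     -((α + α * (LJ ^ 2 + LJ - 1) * d) / 2), d * (β - m)]

/-- The constant `η₁`, with `m = μ / N`. -/
def eta1 (N : ℕ) (d α β m LJ κ : ℝ) : ℝ :=
  α * (1 - d) * (1 - κ) * (1 + d / Real.sqrt N) ^ 2 + d * (β - m) * LJ ^ 2

/-- The constant `η₂`. -/
def eta2 (N : ℕ) (d α LJ : ℝ) : ℝ :=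
  α * (1 + (LJ ^ 2 + LJ - 1) * d) * (1 + d / Real.sqrt N) * LJ

end HeavyAnchor

end

open HeavyAnchor

/-! Write `x̄`, `r̄` for averages over the agents and `x⊥`, `r⊥` for the disagreement parts.
Averaging removes the Laplacian: `x̄' = -𝐅(𝐱)/N - β(x̄ - r̄)` and `r̄' = α(x̄ - r̄)`. At consensus,
with `r̄` frozen, the rest point of the first equation is `𝒥 r̄`, where `𝒥 = (Id + λF)⁻¹` and `λ =
1/(βN)`. The dynamics are thus a perturbed continuous-time proximal-point scheme: `x̄` tracks `𝒥 r̄`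
while `r̄` drifts towards `x̄`.

The interval for `β` says that `μλ < 1` and `μR² < λ`. The first makes `Id + λF` strongly monotone,
so that `𝒥` exists; together they give `κ_𝒥 < 1`, so that `Id - 𝒥` is strongly monotone although `F`
need not be monotone. Hence `𝒥` has a fixed point `x*`, which is a zero of `F` and, by convexity, a
Nash equilibrium (`exists_isResolvent`, `isNashEquilibrium_of_pseudoGradient_eq_zero`).

The Lyapunov function weighs `‖r̄ - x*‖²`, `‖x̄ - 𝒥 r̄‖²`, `‖x⊥‖²` and `‖r⊥‖²`. The weight `β/α` on
the last makes the coupling of `x⊥` and `r⊥` collapse to `-β‖x⊥ - r⊥‖²`. What remains is bounded by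
minus a quadratic form in `√N‖r̄ - x*‖`, `√N‖x̄ - 𝒥 r̄‖`, `‖x⊥‖`. Its leading block is `Φ`, positive
definite by the bound on `α`; the bound on `c λ₂(L)` is the Schur complement condition for the last
variable (`exists_lyapunovRate_le`).

As `𝒥` is only Lipschitz, the term `‖x̄ - 𝒥 r̄‖²` may fail to be differentiable. Monotonicity of `𝒥`
still bounds its right Dini derivative (`eventually_slope_half_norm_sq_lt`), and Grönwall's
inequality then yields exponential decay (`tendsto_zero_of_dini`). -/

namespace HeavyAnchor

/-! ### Strongly monotone operators, the resolvent and Dini derivatives -/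

section Monotone

variable {E : Type*} [NormedAddCommGroup E] [InnerProductSpace ℝ E]

/-- A Lipschitz, strongly monotone operator on a Hilbert space is surjective. -/
theorem surjective_of_stronglyMonotone [CompleteSpace E] {T : E → E} {K : ℝ≥0} {m : ℝ}
    (hT : LipschitzWith K T) (hm : 0 < m)
    (hmono : ∀ x y, m * ‖x - y‖ ^ 2 ≤ inner ℝ (T x - T y) (x - y)) :
    Function.Surjective T := by
  intro z
  -- Since `M ≥ K` and `M > 0` even for `K = 0`, the step size `s = m / M²` satisfies `s K² ≤ m`,
  -- whence `q ≤ 1 - s m < 1`.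
  set M : ℝ := m + K ^ 2 + 1 with hM
  have hK : (0 : ℝ) ≤ K := K.2
  have hMpos : 0 < M := by positivity
  set s : ℝ := m / M ^ 2 with hs
  have hspos : 0 < s := by positivity
  have hmM : m ^ 2 < M ^ 2 := by
    have : m < M := by rw [hM]; nlinarith
    nlinarith
  have hKM : (K : ℝ) ^ 2 ≤ M ^ 2 := by
    have : (K : ℝ) ^ 2 + 1 ≤ M := by rw [hM]; linarith
    nlinarith [sq_nonneg ((K : ℝ) ^ 2)]
  set q : ℝ := 1 - 2 * s * m + s ^ 2 * K ^ 2 with hq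
  have hsM : s * M ^ 2 = m := by rw [hs]; field_simp
  have hq1 : q < 1 := by
    have h1 : s * (K : ℝ) ^ 2 ≤ m := by
      rw [← hsM]; exact mul_le_mul_of_nonneg_left hKM hspos.le
    nlinarith [mul_pos hspos hm]
  have hbound : ∀ x y, ‖(x - s • (T x - z)) - (y - s • (T y - z))‖ ^ 2 ≤ q * ‖x - y‖ ^ 2 := by
    intro x y
    have h0 : (x - s • (T x - z)) - (y - s • (T y - z)) = (x - y) - s • (T x - T y) := by
      simp only [smul_sub]; abel
    have h1 := hmono x y
    have h2 : ‖T x - T y‖ ≤ K * ‖x - y‖ := by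
      simpa [dist_eq_norm] using hT.dist_le_mul x y
    have h3 : ‖T x - T y‖ ^ 2 ≤ (K * ‖x - y‖) ^ 2 := by gcongr
    rw [h0, norm_sub_sq_real, norm_smul, inner_smul_right, real_inner_comm, Real.norm_eq_abs,
      mul_pow, sq_abs]
    have h4 := mul_le_mul_of_nonneg_left h1 hspos.le
    have h5 := mul_le_mul_of_nonneg_left h3 (sq_nonneg s)
    rw [hq]; nlinarith
  have hlip : LipschitzWith (Real.toNNReal (Real.sqrt q)) (fun x => x - s • (T x - z)) := by
    refine LipschitzWith.of_dist_le_mul fun x y => ?_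
    rw [dist_eq_norm, dist_eq_norm, Real.coe_toNNReal _ (Real.sqrt_nonneg _)]
    by_cases hxy : x = y
    · subst hxy; simp
    have hxy' : 0 < ‖x - y‖ ^ 2 := by
      have := norm_pos_iff.mpr (sub_ne_zero.mpr hxy); positivity
    -- In a trivial space `q` could be negative; two distinct points rule this out.
    have hq0 : 0 ≤ q := by
      by_contra hneg
      have := hbound x y
      nlinarith [sq_nonneg ‖(x - s • (T x - z)) - (y - s • (T y - z))‖]
    refine abs_le_of_sq_le_sq' ?_ (by positivity) |>.2
    rw [mul_pow, Real.sq_sqrt hq0]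
    exact hbound x y
  have hcontr : ContractingWith (Real.toNNReal (Real.sqrt q)) (fun x => x - s • (T x - z)) := by
    refine ⟨?_, hlip⟩
    rw [← NNReal.coe_lt_coe, Real.coe_toNNReal _ (Real.sqrt_nonneg _), NNReal.coe_one,
      Real.sqrt_lt' one_pos]
    simpa using hq1
  have hfix : z = T (ContractingWith.fixedPoint _ hcontr) := by
    have := hcontr.fixedPoint_isFixedPt
    have h1 : s • (T (ContractingWith.fixedPoint _ hcontr) - z) = 0 := by
      simpa [Function.IsFixedPt] using this
    rcases smul_eq_zero.mp h1 with h | h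
    · exact absurd h hspos.ne'
    · exact (sub_eq_zero.mp h).symm
  exact ⟨_, hfix.symm⟩

/-- `κ_𝒥` bounds the inner product of increments of the resolvent: here `u` is the increment of
the resolvent, `g` the increment of the operator and `u + l • g` the increment of the argument. -/
theorem inner_le_kappaJ {R μ l : ℝ} (hR : 0 < R) (hl : 0 < l)
    (hμl : μ * l < 1) (hlR : μ * R ^ 2 < l) {u g : E}
    (hinv : ‖u‖ ≤ R * ‖g‖) (hhypo : -μ * ‖u‖ ^ 2 ≤ inner ℝ g u) :
    inner ℝ u (u + l • g) ≤ kappaJ R μ l * ‖u + l • g‖ ^ 2 := by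
  set a := ‖u‖ with ha
  set b := ‖g‖ with hb
  set p : ℝ := inner ℝ g u with hp
  have ha0 : 0 ≤ a := norm_nonneg _
  have hb0 : 0 ≤ b := norm_nonneg _
  have hpab : p ≤ b * a := real_inner_le_norm g u
  have h1 : inner ℝ u (u + l • g) = a ^ 2 + l * p := by
    rw [inner_add_right, inner_smul_right, real_inner_self_eq_norm_sq, real_inner_comm]
  have h2 : ‖u + l • g‖ ^ 2 = a ^ 2 + 2 * l * p + l ^ 2 * b ^ 2 := by
    rw [norm_add_sq_real, norm_smul, inner_smul_right, real_inner_comm, Real.norm_eq_abs, mul_pow,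
      sq_abs]
    ring
  have hab2 : a ^ 2 ≤ R ^ 2 * b ^ 2 := by rw [← mul_pow]; gcongr
  rw [h1, h2, kappaJ]
  -- Once denominators are cleared, the inequality is affine in `p` and its slope has the sign of `R
  -- - l`. So the worst case is the hypomonotone bound `p = -μ a²` when `l ≤ R`, and Cauchy-Schwarz
  -- equality `p = a b` when `l > R`; this explains the two branches of `κ_𝒥`.
  split_ifs with hle
  · have hden : 0 < R ^ 2 + l ^ 2 - 2 * μ * l * R ^ 2 := by
      have : 0 ≤ (l - μ * R ^ 2) ^ 2 := sq_nonneg _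
      nlinarith [mul_pos hl (sub_pos.mpr hlR), mul_pos (mul_pos hR hR) (sub_pos.mpr hμl)]
    rw [div_mul_eq_mul_div, le_div_iff₀ hden]
    have hk : 0 ≤ (1 - μ * l) := by linarith
    have e1 : 0 ≤ (1 - μ * l) * (l ^ 2 * (R ^ 2 * b ^ 2 - a ^ 2)) :=
      mul_nonneg hk (mul_nonneg (sq_nonneg l) (by linarith))
    have e2 : 0 ≤ (p + μ * a ^ 2) * (l * (R ^ 2 - l ^ 2)) := by
      refine mul_nonneg (by linarith) (mul_nonneg hl.le ?_)
      nlinarith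
    nlinarith
  · push Not at hle
    have hden : 0 < R ^ 2 + l ^ 2 + 2 * l * R := by positivity
    have hnum : R ^ 2 * (1 + l / R) / (R ^ 2 + l ^ 2 + 2 * l * R) = R / (R + l) := by
      field_simp
      ring
    rw [hnum, div_mul_eq_mul_div, le_div_iff₀ (by positivity)]
    have e2 : 0 ≤ (a * b - p) := by linarith
    -- At `p = a b` this expression factors as `(R b - a)(a + l b)`.
    have key : 0 ≤ R * p + R * l * b ^ 2 - a ^ 2 - l * p := by
      have f1 : 0 ≤ (l - R) * (a * b - p) := mul_nonneg (by linarith) e2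
      nlinarith [mul_nonneg (sub_nonneg.mpr hinv) (mul_nonneg hl.le hb0),
        mul_nonneg (sub_nonneg.mpr hinv) ha0]
    nlinarith [mul_nonneg hl.le key]

theorem lipJ_den_pos {R μ l : ℝ} (hR : 0 < R) (hl : 0 < l)
    (hμl : μ * l < 1) (hlR : μ * R ^ 2 < l) : 0 < R ^ 2 + l ^ 2 - 2 * l * μ * R ^ 2 := by
  nlinarith [mul_pos hl (sub_pos.mpr hlR), mul_pos (mul_pos hR hR) (sub_pos.mpr hμl)]

theorem norm_le_lipJ {R μ l : ℝ} (hR : 0 < R) (hl : 0 < l)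
    (hμl : μ * l < 1) (hlR : μ * R ^ 2 < l) {u g : E}
    (hinv : ‖u‖ ≤ R * ‖g‖) (hhypo : -μ * ‖u‖ ^ 2 ≤ inner ℝ g u) :
    ‖u‖ ≤ lipJ R μ l * ‖u + l • g‖ := by
  have hden := lipJ_den_pos hR hl hμl hlR
  have hnn : 0 ≤ lipJ R μ l := Real.sqrt_nonneg _
  refine abs_le_of_sq_le_sq' ?_ (by positivity) |>.2
  rw [mul_pow, lipJ, Real.sq_sqrt (by positivity), div_mul_eq_mul_div, le_div_iff₀ hden]
  have h2 : ‖u + l • g‖ ^ 2 = ‖u‖ ^ 2 + 2 * l * inner ℝ g u + l ^ 2 * ‖g‖ ^ 2 := by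
    rw [norm_add_sq_real, norm_smul, inner_smul_right, real_inner_comm, Real.norm_eq_abs, mul_pow,
      sq_abs]
    ring
  have hab2 : ‖u‖ ^ 2 ≤ R ^ 2 * ‖g‖ ^ 2 := by rw [← mul_pow]; gcongr
  rw [h2]
  have e1 := mul_le_mul_of_nonneg_left hhypo (by positivity : 0 ≤ 2 * l * R ^ 2)
  have e2 := mul_le_mul_of_nonneg_left hab2 (sq_nonneg l)
  nlinarith

theorem kappaJ_lt_one {R μ l : ℝ} (hR : 0 < R) (hl : 0 < l)
    (hμl : μ * l < 1) (hlR : μ * R ^ 2 < l) : kappaJ R μ l < 1 := by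
  have hden := lipJ_den_pos hR hl hμl hlR
  rw [kappaJ]
  split_ifs with hle
  · rw [div_lt_one (by linarith)]
    nlinarith [mul_pos hl (sub_pos.mpr hlR)]
  · rw [div_lt_one (by positivity)]
    have : R ^ 2 * (1 + l / R) = R ^ 2 + l * R := by field_simp
    rw [this]
    nlinarith [mul_pos hl hR, mul_pos hl hl]

/-- Properties of the resolvent `(Id + l F)⁻¹` of a hypomonotone, Lipschitz and inverse Lipschitz
operator `F` together with a zero `xs` of `F`. -/
structure IsResolvent (F Jr : E → E) (l LJ κ : ℝ) (xs : E) : Prop where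
  eq : ∀ z, Jr z + l • F (Jr z) = z
  lip : ∀ x y, ‖Jr x - Jr y‖ ≤ LJ * ‖x - y‖
  inner_le : ∀ x y, inner ℝ (Jr x - Jr y) (x - y) ≤ κ * ‖x - y‖ ^ 2
  mono : ∀ x y, 0 ≤ inner ℝ (Jr x - Jr y) (x - y)
  zero : F xs = 0
  fix : Jr xs = xs

/-- Surjectivity of strongly monotone maps is used twice: for `Id + l F`, with modulus `1 - μ l`, to
build the resolvent, and for `Id - 𝒥`, with modulus `1 - κ_𝒥`, to find its fixed point. -/
theorem exists_isResolvent [CompleteSpace E] {F : E → E} {LF R : ℝ≥0} {μ l : ℝ}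
    (hLip : LipschitzWith LF F) (hInv : AntilipschitzWith R F) (hHypo : Hypomonotone μ F)
    (hR : 0 < R) (hl : 0 < l) (hμl : μ * l < 1) (hlR : μ * (R : ℝ) ^ 2 < l) :
    ∃ (Jr : E → E) (xs : E), IsResolvent F Jr l (lipJ R μ l) (kappaJ R μ l) xs := by
  have hR' : (0 : ℝ) < R := by exact_mod_cast hR
  have hinv : ∀ x y, ‖x - y‖ ≤ R * ‖F x - F y‖ := fun x y => by
    simpa [dist_eq_norm] using hInv.le_mul_dist x y
  have hsurj : Function.Surjective (fun x => x + l • F x) := by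
    have hlip : LipschitzWith (1 + ‖l‖₊ * LF) (fun x => x + l • F x) :=
      LipschitzWith.id.add ((lipschitzWith_smul l).comp hLip)
    refine surjective_of_stronglyMonotone (m := 1 - μ * l) hlip (by linarith) fun x y => ?_
    have h0 : (x + l • F x) - (y + l • F y) = (x - y) + l • (F x - F y) := by
      rw [smul_sub]; abel
    rw [h0, inner_add_left, inner_smul_left, real_inner_self_eq_norm_sq]
    have := mul_le_mul_of_nonneg_left (hHypo x y) hl.le
    simp only [conj_trivial]
    nlinarith
  choose Jr hJr using hsurj
  have hdiff : ∀ x y, (Jr x - Jr y) + l • (F (Jr x) - F (Jr y)) = x - y := fun x y => by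
    nth_rewrite 3 [← hJr x]
    nth_rewrite 3 [← hJr y]
    simp only [smul_sub]; abel
  have hlip : ∀ x y, ‖Jr x - Jr y‖ ≤ lipJ R μ l * ‖x - y‖ := fun x y => by
    have := norm_le_lipJ hR' hl hμl hlR (hinv (Jr x) (Jr y)) (hHypo (Jr x) (Jr y))
    rwa [hdiff] at this
  have hkap : ∀ x y, inner ℝ (Jr x - Jr y) (x - y) ≤ kappaJ R μ l * ‖x - y‖ ^ 2 := fun x y => by
    have := inner_le_kappaJ hR' hl hμl hlR (hinv (Jr x) (Jr y)) (hHypo (Jr x) (Jr y))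
    rwa [hdiff] at this
  have hmono : ∀ x y, 0 ≤ inner ℝ (Jr x - Jr y) (x - y) := fun x y => by
    rw [← hdiff x y, inner_add_right, inner_smul_right, real_inner_self_eq_norm_sq,
      real_inner_comm]
    have := mul_le_mul_of_nonneg_left (hHypo (Jr x) (Jr y)) hl.le
    nlinarith [mul_nonneg (sub_nonneg.mpr hμl.le) (sq_nonneg ‖Jr x - Jr y‖)]
  have hnn : 0 ≤ lipJ R μ l := Real.sqrt_nonneg _
  have hlip' : LipschitzWith (1 + (lipJ R μ l).toNNReal) (fun x => x - Jr x) :=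
    LipschitzWith.id.sub (LipschitzWith.of_dist_le_mul fun x y => by
      rw [dist_eq_norm, dist_eq_norm, Real.coe_toNNReal _ hnn]; exact hlip x y)
  obtain ⟨xs, hxs⟩ := surjective_of_stronglyMonotone (m := 1 - kappaJ R μ l) hlip'
    (by linarith [kappaJ_lt_one hR' hl hμl hlR]) (fun x y => by
      have h0 : (x - Jr x) - (y - Jr y) = (x - y) - (Jr x - Jr y) := by abel
      rw [h0, inner_sub_left, real_inner_self_eq_norm_sq]
      linarith [hkap x y]) 0
  have hfix : Jr xs = xs := (sub_eq_zero.mp hxs).symm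
  refine ⟨Jr, xs, hJr, hlip, hkap, hmono, ?_, hfix⟩
  have h1 : Jr xs + l • F (Jr xs) = xs := hJr xs
  rw [hfix, add_eq_left] at h1
  exact (smul_eq_zero.mp h1).resolve_left hl.ne'

/-- Upper bound on the right Dini derivative of `½‖x - 𝒥 r‖²` for a monotone Lipschitz map `𝒥`,
which need not be differentiable. -/
theorem eventually_slope_half_norm_sq_lt {Jr : E → E} {LJ a : ℝ} (ha : 0 ≤ a)
    (hlip : ∀ x y, ‖Jr x - Jr y‖ ≤ LJ * ‖x - y‖)
    (hmono : ∀ x y, 0 ≤ inner ℝ (Jr x - Jr y) (x - y))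
    {x r : ℝ → E} {x' q : E} {t ρ : ℝ}
    (hx : HasDerivWithinAt x x' (Set.Ioi t) t)
    (hr : HasDerivWithinAt r (a • ((x t - Jr (r t)) + q)) (Set.Ioi t) t)
    (hρ : inner ℝ (x t - Jr (r t)) x' + LJ * ‖x t - Jr (r t)‖ * (a * ‖q‖) < ρ) :
    ∀ᶠ z in 𝓝[>] t, (z - t)⁻¹ *
      (‖x z - Jr (r z)‖ ^ 2 / 2 - ‖x t - Jr (r t)‖ ^ 2 / 2) < ρ := by
  set w := x t - Jr (r t) with hw
  have hsx : Tendsto (slope x t) (𝓝[>] t) (𝓝 x') :=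
    (hasDerivWithinAt_iff_tendsto_slope' (by simp)).mp hx
  have hsr : Tendsto (slope r t) (𝓝[>] t) (𝓝 (a • (w + q))) :=
    (hasDerivWithinAt_iff_tendsto_slope' (by simp)).mp hr
  have hdx : Tendsto (fun z => x z - x t) (𝓝[>] t) (𝓝 0) := by
    simpa using hx.continuousWithinAt.tendsto.sub_const (x t)
  have hdr : Tendsto (fun z => r z - r t) (𝓝[>] t) (𝓝 0) := by
    simpa using hr.continuousWithinAt.tendsto.sub_const (r t)
  -- An explicit majorant of the difference quotient; its last summand controls the quadratic
  -- remainder and vanishes in the limit.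
  have hlim : Tendsto (fun z => inner ℝ w (slope x t z) + LJ * ‖w‖ * ‖slope r t z - a • w‖
      + (‖slope x t z‖ + LJ * ‖slope r t z‖) * (‖x z - x t‖ + LJ * ‖r z - r t‖) / 2)
      (𝓝[>] t) (𝓝 (inner ℝ w x' + LJ * ‖w‖ * ‖a • (w + q) - a • w‖
      + (‖x'‖ + LJ * ‖a • (w + q)‖) * (‖(0 : E)‖ + LJ * ‖(0 : E)‖) / 2)) := by
    refine ((tendsto_const_nhds.inner hsx).add (((hsr.sub_const _).norm).const_mul _)).add ?_
    exact ((hsx.norm.add (hsr.norm.const_mul _)).mul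
      (hdx.norm.add (hdr.norm.const_mul _))).div_const 2
  have hval : inner ℝ w x' + LJ * ‖w‖ * ‖a • (w + q) - a • w‖
      + (‖x'‖ + LJ * ‖a • (w + q)‖) * (‖(0 : E)‖ + LJ * ‖(0 : E)‖) / 2
      = inner ℝ w x' + LJ * ‖w‖ * (a * ‖q‖) := by
    rw [← smul_sub, add_sub_cancel_left, norm_smul, Real.norm_of_nonneg ha]
    simp
  rw [hval] at hlim
  filter_upwards [hlim.eventually (gt_mem_nhds hρ), self_mem_nhdsWithin] with z hz hzt
  refine lt_of_le_of_lt ?_ hz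
  have hh : 0 < z - t := sub_pos.mpr hzt
  set h := z - t with hhdef
  have ex : x z - x t = h • slope x t z := by
    rw [slope_def_module, smul_smul, mul_inv_cancel₀ hh.ne', one_smul]
  have er : r z - r t = h • slope r t z := by
    rw [slope_def_module, smul_smul, mul_inv_cancel₀ hh.ne', one_smul]
  set sx := slope x t z
  set sr := slope r t z
  set dJ := Jr (r z) - Jr (r t) with hdJ
  have hwz : x z - Jr (r z) = w + (h • sx - dJ) := by
    rw [hw, hdJ, ← ex]; abel
  have hdJn : ‖dJ‖ ≤ LJ * ‖r z - r t‖ := hlip _ _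
  have hinner : -inner ℝ w dJ ≤ LJ * ‖w‖ * (h * ‖sr - a • w‖) := by
    -- Through the intermediate point `r t + (h a) w`, the displacement along `w` has a favourable
    -- sign by monotonicity, and only the rest of `r'`, namely `a q`, is paid for with the Lipschitz
    -- constant.
    have hsplit : dJ = (Jr (r z) - Jr (r t + (h * a) • w)) + (Jr (r t + (h * a) • w) - Jr (r t)) := by
      rw [hdJ]; abel
    have h1 := hmono (r t + (h * a) • w) (r t)
    rw [add_sub_cancel_left, inner_smul_right, real_inner_comm] at h1
    have h2 : 0 ≤ inner ℝ w (Jr (r t + (h * a) • w) - Jr (r t)) ∨ h * a = 0 := by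
      rcases (mul_nonneg hh.le ha).eq_or_lt with h0 | h0
      · exact Or.inr h0.symm
      · exact Or.inl (nonneg_of_mul_nonneg_right h1 h0)
    have h2' : 0 ≤ inner ℝ w (Jr (r t + (h * a) • w) - Jr (r t)) := by
      rcases h2 with h2 | h2
      · exact h2
      · rw [h2]; simp
    have h3 : ‖Jr (r z) - Jr (r t + (h * a) • w)‖ ≤ LJ * (h * ‖sr - a • w‖) := by
      refine (hlip _ _).trans (le_of_eq ?_)
      have : r z - (r t + (h * a) • w) = h • (sr - a • w) := by
        rw [smul_sub h sr, ← er, smul_smul]; abel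
      rw [this, norm_smul, Real.norm_of_nonneg hh.le]
    have h4 : -(‖w‖ * ‖Jr (r z) - Jr (r t + (h * a) • w)‖)
        ≤ inner ℝ w (Jr (r z) - Jr (r t + (h * a) • w)) :=
      neg_le_of_abs_le (abs_real_inner_le_norm _ _)
    rw [hsplit, inner_add_right]
    nlinarith [mul_le_mul_of_nonneg_left h3 (norm_nonneg w)]
  have hsq : ‖h • sx - dJ‖ ^ 2 ≤ h * ((‖sx‖ + LJ * ‖sr‖) * (‖x z - x t‖ + LJ * ‖r z - r t‖)) := by
    have h1 : ‖h • sx - dJ‖ ≤ ‖x z - x t‖ + LJ * ‖r z - r t‖ := by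
      rw [← ex]; exact (norm_sub_le _ _).trans (by gcongr)
    have h2 : ‖x z - x t‖ + LJ * ‖r z - r t‖ = h * (‖sx‖ + LJ * ‖sr‖) := by
      rw [ex, er, norm_smul, norm_smul, Real.norm_of_nonneg hh.le]; ring
    calc ‖h • sx - dJ‖ ^ 2 ≤ (‖x z - x t‖ + LJ * ‖r z - r t‖) ^ 2 := by gcongr
      _ = (h * (‖sx‖ + LJ * ‖sr‖)) * (‖x z - x t‖ + LJ * ‖r z - r t‖) := by rw [← h2]; ring
      _ = _ := by ring
  rw [hwz, norm_add_sq_real, inner_sub_right, inner_smul_right, inv_mul_le_iff₀ hh]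
  nlinarith

end Monotone

/-- A quadratic form in `(a, b, e)` is positive definite if its leading `2 × 2` block is and its
last diagonal entry exceeds the Schur complement bound. -/
theorem exists_quadratic_form_lower_bound {p₁ p₂ o u v s : ℝ} (hp₁ : 0 < p₁) (hp₂ : 0 < p₂)
    (hdet : 0 < p₁ * p₂ - o ^ 2)
    (hs : (p₂ * u ^ 2 - 2 * o * u * v + p₁ * v ^ 2) / (4 * (p₁ * p₂ - o ^ 2)) < s) :
    ∃ ε > 0, ∀ a b e : ℝ, ε * (a ^ 2 + b ^ 2 + e ^ 2) ≤
      p₁ * a ^ 2 + 2 * o * a * b + p₂ * b ^ 2 - u * a * e - v * b * e + s * e ^ 2 := by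
  set D := p₁ * p₂ - o ^ 2 with hD
  set K := (p₂ * u ^ 2 - 2 * o * u * v + p₁ * v ^ 2) / (4 * D) with hK
  have hKD : p₂ * u ^ 2 - 2 * o * u * v + p₁ * v ^ 2 = 4 * D * K := by
    rw [hK]; field_simp
  have hK0 : 0 ≤ K := by
    refine div_nonneg ?_ (by positivity)
    refine nonneg_of_mul_nonneg_right (a := p₁) ?_ hp₁
    have : p₁ * (p₂ * u ^ 2 - 2 * o * u * v + p₁ * v ^ 2) = (p₁ * v - o * u) ^ 2 + D * u ^ 2 := by
      rw [hD]; ring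
    rw [this]; positivity
  have hs0 : 0 < s := lt_of_le_of_lt hK0 hs
  set q : ℝ → ℝ → ℝ := fun a b => p₁ * a ^ 2 + 2 * o * a * b + p₂ * b ^ 2 with hq
  -- Determinant over trace is a lower bound for the smaller eigenvalue of the block.
  have hqlow : ∀ a b, D / (p₁ + p₂) * (a ^ 2 + b ^ 2) ≤ q a b := by
    intro a b
    rw [div_mul_eq_mul_div, div_le_iff₀ (by positivity)]
    have : q a b * (p₁ + p₂) - D * (a ^ 2 + b ^ 2) = (p₁ * a + o * b) ^ 2 + (o * a + p₂ * b) ^ 2 := by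
      simp only [hq, hD]; ring
    nlinarith [sq_nonneg (p₁ * a + o * b), sq_nonneg (o * a + p₂ * b)]
  have hcs : ∀ a b, (u * a + v * b) ^ 2 ≤ 4 * K * q a b := by
    intro a b
    have h1 : D * (4 * K * q a b - (u * a + v * b) ^ 2)
        = ((p₁ * v - o * u) * a + (o * v - p₂ * u) * b) ^ 2 := by
      have : D * (4 * K * q a b) = (p₂ * u ^ 2 - 2 * o * u * v + p₁ * v ^ 2) * q a b := by
        rw [hKD]; ring
      rw [mul_sub, this]; simp only [hq, hD]; ring
    have h2 : 0 ≤ 4 * K * q a b - (u * a + v * b) ^ 2 :=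
      nonneg_of_mul_nonneg_right (by rw [h1]; positivity) hdet
    linarith
  -- The midpoint of `K / s` and `1`: a fraction `τ` of `q` absorbs the cross term at a cost `K / τ
  -- < s` in `e²`, and the fraction `1 - τ` is left over.
  set τ := (K + s) / (2 * s) with hτ
  have hτ0 : 0 < τ := by positivity
  have hτ1 : 0 < 1 - τ := by
    have : 1 - τ = (s - K) / (2 * s) := by rw [hτ]; field_simp; ring
    rw [this]; exact div_pos (by linarith) (by positivity)
  have hsK : 0 < s - K / τ := by
    have : s - K / τ = s * (s - K) / (K + s) := by
      rw [hτ]; field_simp; ring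
    rw [this]; exact div_pos (mul_pos hs0 (by linarith)) (by linarith)
  have hcross : ∀ a b e, (u * a + v * b) * e ≤ τ * q a b + K / τ * e ^ 2 := by
    intro a b e
    have hq0 : 0 ≤ q a b := le_trans (by positivity) (hqlow a b)
    have hrhs : 0 ≤ τ * q a b + K / τ * e ^ 2 := by positivity
    refine (abs_le_of_sq_le_sq' ?_ hrhs).2
    calc ((u * a + v * b) * e) ^ 2 ≤ 4 * K * q a b * e ^ 2 := by
          rw [mul_pow]; exact mul_le_mul_of_nonneg_right (hcs a b) (sq_nonneg e)
      _ = 4 * (τ * q a b) * (K / τ * e ^ 2) := by field_simp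
      _ ≤ (τ * q a b + K / τ * e ^ 2) ^ 2 := by
          nlinarith [sq_nonneg (τ * q a b - K / τ * e ^ 2)]
  refine ⟨min ((1 - τ) * (D / (p₁ + p₂))) (s - K / τ), lt_min (by positivity) hsK,
    fun a b e => ?_⟩
  have h1 := hcross a b e
  have h2 := mul_le_mul_of_nonneg_left (hqlow a b) hτ1.le
  have h3 : min ((1 - τ) * (D / (p₁ + p₂))) (s - K / τ) * (a ^ 2 + b ^ 2)
      ≤ (1 - τ) * (D / (p₁ + p₂)) * (a ^ 2 + b ^ 2) :=
    mul_le_mul_of_nonneg_right (min_le_left _ _) (by positivity)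
  have h4 : min ((1 - τ) * (D / (p₁ + p₂))) (s - K / τ) * e ^ 2 ≤ (s - K / τ) * e ^ 2 :=
    mul_le_mul_of_nonneg_right (min_le_right _ _) (by positivity)
  have h5 : q a b = p₁ * a ^ 2 + 2 * o * a * b + p₂ * b ^ 2 := rfl
  linarith

/-! ### Global existence for Lipschitz autonomous equations -/

section ODE

variable {E : Type*} [NormedAddCommGroup E] [NormedSpace ℝ E] [CompleteSpace E]

/-- The length `T` is limited by `K` alone and not by `x₀`, so pieces of equal length can be
concatenated. With `K T ≤ 1/2`, the ball of radius `2‖f x₀‖T` meets the Picard-Lindelöf condition.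
-/
theorem exists_solution_Icc_of_lipschitz {f : E → E} {K : ℝ≥0} (hf : LipschitzWith K f)
    {T : ℝ} (hT : 0 ≤ T) (hKT : K * T ≤ 1 / 2) (x₀ : E) :
    ∃ u : ℝ → E, u 0 = x₀ ∧
      ∀ t ∈ Set.Icc 0 T, HasDerivWithinAt u (f (u t)) (Set.Icc 0 T) t := by
  set a : ℝ≥0 := 2 * ‖f x₀‖₊ * T.toNNReal with ha
  have haR : (a : ℝ) = 2 * ‖f x₀‖ * T := by simp [ha, hT]
  have hb : ∀ x ∈ Metric.closedBall x₀ a, ‖f x‖ ≤ (‖f x₀‖₊ + K * a : ℝ≥0) := by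
    intro x hx
    have h1 : ‖f x - f x₀‖ ≤ K * ‖x - x₀‖ := by
      simpa [dist_eq_norm] using hf.dist_le_mul x x₀
    have h2 : ‖x - x₀‖ ≤ a := by simpa [dist_eq_norm] using hx
    have h3 : ‖f x‖ ≤ ‖f x₀‖ + ‖f x - f x₀‖ := norm_le_norm_add_norm_sub' _ _
    have h4 := mul_le_mul_of_nonneg_left h2 K.2
    push_cast
    exact h3.trans (by gcongr; exact h1.trans h4)
  have hPL : IsPicardLindelof (fun _ => f) (⟨0, Set.left_mem_Icc.mpr hT⟩ : Set.Icc (0 : ℝ) T) x₀ a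
      0 (‖f x₀‖₊ + K * a) K := by
    refine IsPicardLindelof.of_time_independent hb hf.lipschitzOnWith ?_
    simp only [sub_zero, sub_self, max_eq_left hT, NNReal.coe_zero]
    push_cast
    rw [haR]
    have : ‖f x₀‖ * T * (K * T) ≤ ‖f x₀‖ * T * (1 / 2) :=
      mul_le_mul_of_nonneg_left hKT (by positivity)
    nlinarith
  exact hPL.exists_eq_forall_mem_Icc_hasDerivWithinAt₀

/-- An autonomous ODE with a globally Lipschitz right-hand side has a solution on `[0, ∞)` from
every initial condition. -/
theorem exists_solution_Ici_of_lipschitz {f : E → E} {K : ℝ≥0} (hf : LipschitzWith K f) (x₀ : E) :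
    ∃ u : ℝ → E, u 0 = x₀ ∧
      ∀ t : ℝ, 0 ≤ t → HasDerivWithinAt u (f (u t)) (Set.Ici 0) t := by
  obtain ⟨T, hT, hKT⟩ : ∃ T : ℝ, 0 < T ∧ K * T ≤ 1 / 2 := by
    refine ⟨1 / (2 * (K + 1)), by positivity, ?_⟩
    rw [mul_one_div, div_le_div_iff₀ (by positivity) (by positivity)]
    linarith
  choose flow hflow0 hflow using fun x => exists_solution_Icc_of_lipschitz hf hT.le hKT x
  set y : ℕ → E := fun k => Nat.rec x₀ (fun _ z => flow z T) k with hy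
  have hysucc : ∀ k, y (k + 1) = flow (y k) T := fun k => rfl
  set u : ℝ → E := fun t => flow (y ⌊t / T⌋₊) (t - ⌊t / T⌋₊ * T) with hu
  have hpiece : ∀ k : ℕ, ∀ t ∈ Set.Icc (k * T) ((k + 1) * T), u t = flow (y k) (t - k * T) := by
    intro k t ht
    -- At the right endpoint the floor is already `k + 1`; the value agrees because `y (k + 1)` is
    -- the endpoint of the previous piece.
    rcases ht.2.eq_or_lt with h | h
    · have h1 : t / T = ((k + 1 : ℕ) : ℝ) := by rw [h]; push_cast; field_simp
      simp only [hu]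
      rw [h1, Nat.floor_natCast, h, hysucc]
      push_cast
      rw [sub_self, hflow0]
      congr 1; ring
    · have h1 : ⌊t / T⌋₊ = k := by
        rw [Nat.floor_eq_iff (div_nonneg (le_trans (by positivity) ht.1) hT.le)]
        exact ⟨(le_div_iff₀ hT).mpr ht.1, (div_lt_iff₀ hT).mpr h⟩
      simp only [hu]
      rw [h1]
  have hderiv : ∀ k : ℕ, ∀ t ∈ Set.Icc (k * T) ((k + 1) * T),
      HasDerivWithinAt u (f (u t)) (Set.Icc (k * T) ((k + 1) * T)) t := by
    intro k t ht
    have hmaps : Set.MapsTo (fun s => s - k * T) (Set.Icc (k * T) ((k + 1) * T)) (Set.Icc 0 T) := by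
      intro s hs
      exact ⟨by linarith [hs.1], by linarith [hs.2]⟩
    have h1 := (hflow (y k) (t - k * T) (hmaps ht)).scomp t
      ((hasDerivWithinAt_id t _).sub_const (k * T)) hmaps
    rw [one_smul] at h1
    rw [hpiece k t ht]
    exact h1.congr (fun s hs => hpiece k s hs) (hpiece k t ht)
  have hmain : ∀ k : ℕ, ∀ t ∈ Set.Icc 0 (k * T),
      0 < k → HasDerivWithinAt u (f (u t)) (Set.Icc 0 (k * T)) t := by
    intro k
    induction k with
    | zero => intro t _ h; exact absurd h (lt_irrefl 0)
    | succ k ih =>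
      intro t ht _
      push_cast at ht ⊢
      rcases Nat.eq_zero_or_pos k with rfl | hk
      · have := hderiv 0 t (by simpa using ht)
        simpa using this
      have hunion : Set.Icc 0 ((k + 1) * T) = Set.Icc 0 (k * T) ∪ Set.Icc (k * T) ((k + 1) * T) :=
        (Set.Icc_union_Icc_eq_Icc (by positivity) (by nlinarith)).symm
      rcases lt_trichotomy t (k * T) with h | h | h
      · refine (ih t ⟨ht.1, h.le⟩ hk).mono_of_mem_nhdsWithin ?_
        filter_upwards [self_mem_nhdsWithin, mem_nhdsWithin_of_mem_nhds (Iio_mem_nhds h)]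
          with s hs hs' using ⟨hs.1, le_of_lt hs'⟩
      · rw [hunion]
        exact (ih t ⟨ht.1, h.le⟩ hk).union (hderiv k t ⟨h.ge, ht.2⟩)
      · refine (hderiv k t ⟨h.le, ht.2⟩).mono_of_mem_nhdsWithin ?_
        filter_upwards [self_mem_nhdsWithin, mem_nhdsWithin_of_mem_nhds (Ioi_mem_nhds h)]
          with s hs hs' using ⟨le_of_lt hs', hs.2⟩
  refine ⟨u, ?_, fun t ht => ?_⟩
  · have := hpiece 0 0 (by simp [hT.le])
    rw [this, Nat.cast_zero, zero_mul, sub_zero]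
    exact hflow0 x₀
  · obtain ⟨k, hk⟩ := exists_nat_gt (t / T)
    have hk' : t < k * T := (div_lt_iff₀ hT).mp hk
    have hk0 : 0 < k := by
      have : (0 : ℝ) < k := lt_of_le_of_lt (div_nonneg ht hT.le) hk
      exact_mod_cast this
    refine (hmain k t ⟨ht, hk'.le⟩ hk0).mono_of_mem_nhdsWithin ?_
    filter_upwards [self_mem_nhdsWithin, mem_nhdsWithin_of_mem_nhds (Iio_mem_nhds hk')]
      with s hs hs' using ⟨hs, le_of_lt hs'⟩

end ODE

/-! ### Spectral bound for the weighted Laplacian -/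

section Laplacian

variable {N : ℕ}

namespace WeightedGraph

theorem laplacian_apply (G : WeightedGraph N) (i j : Fin N) :
    G.laplacian i j = (if i = j then ∑ k, G.weight i k else 0) - G.weight i j := by
  simp [laplacian, Matrix.diagonal_apply]

theorem weight_nonneg (G : WeightedGraph N) (i j : Fin N) : 0 ≤ G.weight i j := by
  by_cases h : G.graph.Adj i j
  · exact (G.weight_pos i j h).le
  · exact (G.weight_zero i j h).ge

theorem sum_laplacian_row (G : WeightedGraph N) (i : Fin N) : ∑ j, G.laplacian i j = 0 := by
  simp [laplacian_apply, Finset.sum_sub_distrib]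

theorem laplacian_symm (G : WeightedGraph N) (i j : Fin N) :
    G.laplacian i j = G.laplacian j i := by
  simpa using (G.laplacian_isHermitian.apply j i)

theorem sum_laplacian_col (G : WeightedGraph N) (j : Fin N) : ∑ i, G.laplacian i j = 0 := by
  simp_rw [G.laplacian_symm _ j]
  exact G.sum_laplacian_row j

theorem quadraticForm_laplacian (G : WeightedGraph N) (v : Fin N → ℝ) :
    ∑ i, ∑ j, G.laplacian i j * (v i * v j)
      = (∑ i, ∑ j, G.weight i j * (v i - v j) ^ 2) / 2 := by
  have h1 : ∑ i, ∑ j, G.laplacian i j * (v i * v j)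
      = ∑ i, ∑ j, (G.weight i j * v i ^ 2 - G.weight i j * (v i * v j)) := by
    refine Finset.sum_congr rfl fun i _ => ?_
    simp only [laplacian_apply, sub_mul, ite_mul, zero_mul, Finset.sum_sub_distrib,
      Finset.sum_ite_eq, Finset.mem_univ, if_true, Finset.sum_mul]
    simp [sq]
  have h2 : ∑ i, ∑ j, G.weight i j * v i ^ 2 = ∑ i, ∑ j, G.weight i j * v j ^ 2 := by
    rw [Finset.sum_comm]
    simp_rw [G.weight_symm]
  have h3 : ∑ i, ∑ j, G.weight i j * (v i - v j) ^ 2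
      = ∑ i, ∑ j, G.weight i j * v i ^ 2 + ∑ i, ∑ j, G.weight i j * v j ^ 2
        - 2 * ∑ i, ∑ j, G.weight i j * (v i * v j) := by
    simp only [Finset.mul_sum, ← Finset.sum_add_distrib, ← Finset.sum_sub_distrib]
    refine Finset.sum_congr rfl fun i _ => Finset.sum_congr rfl fun j _ => by ring
  rw [h1, h3, ← h2]
  simp only [Finset.sum_sub_distrib]
  ring

theorem quadraticForm_laplacian_nonneg (G : WeightedGraph N) (v : Fin N → ℝ) :
    0 ≤ ∑ i, ∑ j, G.laplacian i j * (v i * v j) := by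
  rw [quadraticForm_laplacian]
  refine div_nonneg (Finset.sum_nonneg fun i _ => Finset.sum_nonneg fun j _ => ?_) zero_le_two
  exact mul_nonneg (G.weight_nonneg i j) (sq_nonneg _)

theorem inner_toEuclideanLin_laplacian (G : WeightedGraph N) (v w : EuclideanSpace ℝ (Fin N)) :
    inner ℝ v (Matrix.toEuclideanLin G.laplacian w)
      = ∑ i, ∑ j, G.laplacian i j * (v i * w j) := by
  simp only [PiLp.inner_apply, Matrix.toLpLin_apply, Matrix.mulVec, dotProduct,
    RCLike.inner_apply, conj_trivial, Finset.sum_mul]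
  refine Finset.sum_congr rfl fun i _ => Finset.sum_congr rfl fun j _ => by ring

theorem toEuclideanLin_eigenvectorBasis (G : WeightedGraph N) (i : Fin N) :
    Matrix.toEuclideanLin G.laplacian (G.laplacian_isHermitian.eigenvectorBasis i)
      = G.laplacian_isHermitian.eigenvalues i • G.laplacian_isHermitian.eigenvectorBasis i := by
  have := G.laplacian_isHermitian.mulVec_eigenvectorBasis i
  ext k
  simpa [Matrix.toLpLin_apply] using congrFun this k

theorem inner_eigenvectorBasis_toEuclideanLin (G : WeightedGraph N) (i : Fin N)
    (v : EuclideanSpace ℝ (Fin N)) :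
    inner ℝ (G.laplacian_isHermitian.eigenvectorBasis i) (Matrix.toEuclideanLin G.laplacian v)
      = G.laplacian_isHermitian.eigenvalues i
        * inner ℝ (G.laplacian_isHermitian.eigenvectorBasis i) v := by
  rw [← (Matrix.isSymmetric_toEuclideanLin_iff.mpr G.laplacian_isHermitian) _ v,
    toEuclideanLin_eigenvectorBasis, inner_smul_left, conj_trivial]

theorem eigenvalues_laplacian_nonneg (G : WeightedGraph N) (i : Fin N) :
    0 ≤ G.laplacian_isHermitian.eigenvalues i := by
  have h1 := inner_eigenvectorBasis_toEuclideanLin G i (G.laplacian_isHermitian.eigenvectorBasis i)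
  rw [inner_toEuclideanLin_laplacian, real_inner_self_eq_norm_sq, OrthonormalBasis.norm_eq_one,
    one_pow, mul_one] at h1
  rw [← h1]
  exact G.quadraticForm_laplacian_nonneg _

theorem lambda2_nonneg (G : WeightedGraph N) (hN : 2 ≤ N) : 0 ≤ G.lambda2 hN := by
  have := G.eigenvalues_laplacian_nonneg
    ((Fintype.equivOfCardEq (Fintype.card_fin _)) ⟨N - 2, by rw [Fintype.card_fin]; omega⟩)
  simpa [Matrix.IsHermitian.eigenvalues, lambda2] using this

/-- The Laplacian is bounded below by `λ₂` on the orthogonal complement of `𝟏`. -/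
theorem lambda2_mul_le (G : WeightedGraph N) (hN : 2 ≤ N) (v : Fin N → ℝ) (hv : ∑ i, v i = 0) :
    G.lambda2 hN * ∑ i, v i ^ 2 ≤ ∑ i, ∑ j, G.laplacian i j * (v i * v j) := by
  set hA := G.laplacian_isHermitian
  set b := hA.eigenvectorBasis with hb
  set x : EuclideanSpace ℝ (Fin N) := WithLp.toLp 2 v with hx
  set one : EuclideanSpace ℝ (Fin N) := WithLp.toLp 2 (fun _ => 1) with hone
  have hx1 : inner ℝ one x = 0 := by
    simp [hone, hx, PiLp.inner_apply, hv]
  have hker : Matrix.toEuclideanLin G.laplacian one = 0 := by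
    ext k
    simp [hone, Matrix.toLpLin_apply, Matrix.mulVec, dotProduct, G.sum_laplacian_row]
  have hone0 : one ≠ 0 := by
    intro h
    have := congrArg (fun z : EuclideanSpace ℝ (Fin N) => z ⟨0, by omega⟩) h
    simp [hone] at this
  have hnorm : ∑ i, v i ^ 2 = ∑ i, (inner ℝ (b i) x) ^ 2 := by
    rw [b.sum_sq_inner_right, EuclideanSpace.norm_sq_eq]
    simp [hx]
  have hquad : ∑ i, ∑ j, G.laplacian i j * (v i * v j)
      = ∑ i, hA.eigenvalues i * (inner ℝ (b i) x) ^ 2 := by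
    have h1 := inner_toEuclideanLin_laplacian G x x
    rw [← b.sum_inner_mul_inner] at h1
    rw [← show ∑ i, ∑ j, G.laplacian i j * (x i * x j)
      = ∑ i, ∑ j, G.laplacian i j * (v i * v j) from rfl, ← h1]
    refine Finset.sum_congr rfl fun i _ => ?_
    rw [inner_eigenvectorBasis_toEuclideanLin, real_inner_comm]
    ring
  rw [hnorm, hquad, Finset.mul_sum]
  refine Finset.sum_le_sum fun i _ => ?_
  set e : Fin (Fintype.card (Fin N)) ≃ Fin N := Fintype.equivOfCardEq (Fintype.card_fin _) with he
  have hev : ∀ j, hA.eigenvalues j = hA.eigenvalues₀ (e.symm j) := fun j => rfl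
  have hle : ∀ j, (e.symm j : ℕ) ≤ N - 2 → G.lambda2 hN ≤ hA.eigenvalues j := by
    intro j hj
    rw [hev]
    exact hA.eigenvalues₀_antitone (Fin.mk_le_mk.mpr hj : e.symm j ≤ ⟨N - 2, _⟩)
  -- In decreasing order only the last eigenvalue, of index `N - 1`, can be smaller than `λ₂`. If
  -- `λ₂ = 0`, nonnegativity of the spectrum settles that term. If `λ₂ > 0`, every other eigenvector
  -- is orthogonal to the kernel vector `𝟏`, so the last one spans `𝟏` and `v` has no component
  -- along it.
  by_cases hi : (e.symm i : ℕ) ≤ N - 2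
  · exact mul_le_mul_of_nonneg_right (hle i hi) (sq_nonneg _)
  rcases (G.lambda2_nonneg hN).eq_or_lt with h0 | h0
  · rw [← h0, zero_mul]
    exact mul_nonneg (G.eigenvalues_laplacian_nonneg i) (sq_nonneg _)
  have horth : ∀ j, j ≠ i → inner ℝ (b j) one = 0 := by
    intro j hj
    have hjN : (e.symm j : ℕ) ≤ N - 2 := by
      have h1 := (e.symm j).2
      have h2 := (e.symm i).2
      have h3 : (e.symm j : ℕ) ≠ e.symm i := fun h => hj (e.symm.injective (Fin.ext h))
      simp only [Fintype.card_fin] at h1 h2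
      omega
    have h1 := inner_eigenvectorBasis_toEuclideanLin G j one
    rw [hker, inner_zero_right] at h1
    exact (mul_eq_zero.mp h1.symm).resolve_left (h0.trans_le (hle j hjN)).ne'
  have hone_eq : inner ℝ (b i) one • b i = one := by
    conv_rhs => rw [← b.sum_repr' one]
    refine (Finset.sum_eq_single (f := fun j => inner ℝ (b j) one • b j) i (fun j _ hj => ?_)
      fun h => absurd (Finset.mem_univ i) h).symm
    simp only [horth j hj, zero_smul]
  have hi0 : inner ℝ (b i) x = 0 := by
    rw [← hone_eq, inner_smul_left, conj_trivial] at hx1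
    refine (mul_eq_zero.mp hx1).resolve_left fun h => hone0 ?_
    rw [← hone_eq, h, zero_smul]
  rw [hi0]; simp

end WeightedGraph

end Laplacian

/-! ### Nash equilibria and linear algebra on stacked vectors -/

section Game

variable {N : ℕ} {n : Fin N → ℕ}

theorem replaceAction_self (x : Profile n) (i : Fin N) : replaceAction x i (x i) = x := by
  ext j
  simp [replaceAction]

/-- A zero of the pseudo-gradient is a Nash equilibrium. -/
theorem isNashEquilibrium_of_pseudoGradient_eq_zero {J : Fin N → Profile n → ℝ}
    (hJ : RegularCosts J) {x : Profile n} (hx : pseudoGradient J x = 0) :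
    IsNashEquilibrium J x := by
  intro i y
  set g : EuclideanSpace ℝ (Fin (n i)) → ℝ := fun y => J i (replaceAction x i y) with hg
  have hconv : ConvexOn ℝ Set.univ g := hJ.convex i x
  have hdiff : Differentiable ℝ g := by
    have h1 : Differentiable ℝ (J i) := (hJ.contDiff i).differentiable one_ne_zero
    have h2 : Differentiable ℝ (fun y => replaceAction x i y) := by
      refine (differentiable_piLp 2).mpr fun j => ?_
      rcases eq_or_ne j i with rfl | hj
      · simp only [replaceAction, Function.update_self]; exact differentiable_id
      · simp only [replaceAction, Function.update_of_ne hj]; exact differentiable_const _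
    exact h1.comp h2
  have hgrad : fderiv ℝ g (x i) = 0 := by
    have h1 : gradient g (x i) = 0 := by
      have := congrArg (fun z : Profile n => z i) hx
      simpa [pseudoGradient, partialGradient] using this
    simpa [gradient] using h1
  -- Restriction to the line through `x i` and `y` reduces the claim to a convex function of one
  -- variable that is stationary at `0`.
  set φ : ℝ → ℝ := fun s => g (AffineMap.lineMap (x i) y s) with hφ
  have hφconv : ConvexOn ℝ Set.univ φ := by
    have h1 := hconv.comp_affineMap (AffineMap.lineMap (x i) y : ℝ →ᵃ[ℝ] _)
    rw [Set.preimage_univ] at h1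
    exact h1
  have hφd : HasDerivAt φ 0 0 := by
    have h1 : HasFDerivAt g (0 : EuclideanSpace ℝ (Fin (n i)) →L[ℝ] ℝ)
        (AffineMap.lineMap (x i) y (0 : ℝ)) := by
      rw [AffineMap.lineMap_apply_zero, ← hgrad]; exact (hdiff _).hasFDerivAt
    exact h1.comp_hasDerivAt (0 : ℝ) (AffineMap.hasDerivAt_lineMap (x := (0 : ℝ)))
  have hmin : IsMinOn φ Set.univ 0 := by
    refine hφconv.isMinOn_of_rightDeriv_eq_zero (by simp) ?_
    exact hφd.hasDerivWithinAt.derivWithin (uniqueDiffWithinAt_Ioi _)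
  have := hmin (Set.mem_univ 1)
  simp only [hφ, hg, AffineMap.lineMap_apply_zero, AffineMap.lineMap_apply_one,
    replaceAction_self, Set.mem_ofPred_eq] at this
  exact this

theorem norm_sq_aug (X : Aug n) : ‖X‖ ^ 2 = ∑ i, ‖X i‖ ^ 2 := PiLp.norm_sq_eq_of_L2 _ X

/-- Block `i` is a single block of `F(𝐱^i) - F(𝐲^i)`, so the constant of `F` passes over without
loss. -/
theorem norm_extPseudoGradient_sub_le {J : Fin N → Profile n → ℝ} {L_F : ℝ≥0}
    (hLip : LipschitzWith L_F (pseudoGradient J)) (X Y : Aug n) :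
    ‖extPseudoGradient J X - extPseudoGradient J Y‖ ≤ L_F * ‖X - Y‖ := by
  refine (abs_le_of_sq_le_sq' ?_ (by positivity)).2
  rw [PiLp.norm_sq_eq_of_L2, mul_pow, norm_sq_aug, Finset.mul_sum]
  refine Finset.sum_le_sum fun i _ => ?_
  rw [← mul_pow]
  have h1 : ‖pseudoGradient J (X i) - pseudoGradient J (Y i)‖ ≤ L_F * ‖X i - Y i‖ := by
    simpa [dist_eq_norm] using hLip.dist_le_mul (X i) (Y i)
  have h2 : ‖(pseudoGradient J (X i) - pseudoGradient J (Y i)) i‖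
      ≤ ‖pseudoGradient J (X i) - pseudoGradient J (Y i)‖ := PiLp.norm_apply_le _ i
  have h3 : (extPseudoGradient J X - extPseudoGradient J Y) i
      = (pseudoGradient J (X i) - pseudoGradient J (Y i)) i := rfl
  rw [h3]
  exact pow_le_pow_left₀ (norm_nonneg _) (h2.trans h1) 2

theorem extPseudoGradient_consensus (J : Fin N → Profile n → ℝ) (x : Profile n) :
    extPseudoGradient J (consensus x) = pseudoGradient J x := rfl

/-- The average of the agents' estimates. -/
noncomputable def average (X : Aug n) : Profile n := (N : ℝ)⁻¹ • ∑ i, X i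

/-- The averaging map as a continuous linear map. -/
noncomputable def averageCLM : Aug n →L[ℝ] Profile n :=
  LinearMap.toContinuousLinearMap
    { toFun := average
      map_add' := fun X Y => by simp [average, Finset.sum_add_distrib]
      map_smul' := fun a X => by
        simp [average, ← Finset.smul_sum, smul_comm a] }

@[simp] theorem averageCLM_apply (X : Aug n) : averageCLM X = average X := rfl

/-- `x ↦ 𝟏_N ⊗ x` as a continuous linear map. -/
noncomputable def consensusCLM : Profile n →L[ℝ] Aug n :=
  LinearMap.toContinuousLinearMap
    { toFun := consensus
      map_add' := fun _ _ => rfl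
      map_smul' := fun _ _ => rfl }

/-- `𝐱 ↦ (A ⊗ I_n) 𝐱` as a continuous linear map. -/
noncomputable def kronCLM (A : Matrix (Fin N) (Fin N) ℝ) : Aug n →L[ℝ] Aug n :=
  LinearMap.toContinuousLinearMap
    { toFun := kronApply A
      map_add' := fun X Y => by
        refine PiLp.ext fun i => ?_
        simp [kronApply, Finset.sum_add_distrib]
      map_smul' := fun a X => by
        refine PiLp.ext fun i => ?_
        simp [kronApply, Finset.smul_sum, smul_comm a] }

@[simp] theorem kronCLM_apply (A : Matrix (Fin N) (Fin N) ℝ) (X : Aug n) :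
    kronCLM A X = kronApply A X := rfl

/-- `ℛᵀ` as a continuous linear map. -/
noncomputable def embedOwnCLM : Profile n →L[ℝ] Aug n :=
  LinearMap.toContinuousLinearMap
    { toFun := embedOwn
      map_add' := fun v w => by
        refine PiLp.ext fun i => PiLp.ext fun j => ?_
        simp [embedOwn, Pi.single_add]
      map_smul' := fun a v => by
        refine PiLp.ext fun i => PiLp.ext fun j => ?_
        simp [embedOwn, Pi.single_smul] }

theorem norm_embedOwn (v : Profile n) : ‖embedOwn v‖ = ‖v‖ := by
  rw [← sq_eq_sq₀ (norm_nonneg _) (norm_nonneg _), norm_sq_aug, PiLp.norm_sq_eq_of_L2]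
  refine Finset.sum_congr rfl fun i _ => ?_
  have : embedOwn v i = PiLp.single 2 i (v i) := rfl
  rw [this, PiLp.norm_single]

theorem average_embedOwn (v : Profile n) : average (embedOwn v) = (N : ℝ)⁻¹ • v := by
  rw [average]
  congr 1
  refine PiLp.ext fun j => ?_
  simp only [WithLp.ofLp_sum, Finset.sum_apply, embedOwn]
  rw [Finset.sum_eq_single j]
  · simp
  · intro i _ hij; simp [hij.symm]
  · simp

theorem average_consensus (hN : N ≠ 0) (x : Profile n) : average (consensus x) = x := by
  have : (N : ℝ) ≠ 0 := by exact_mod_cast hN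
  simp [average, consensus, ← Nat.cast_smul_eq_nsmul ℝ, smul_smul, this]

theorem average_kronApply_laplacian (G : WeightedGraph N) (X : Aug n) :
    average (kronApply G.laplacian X) = 0 := by
  simp only [average, kronApply]
  rw [Finset.sum_comm]
  simp [← Finset.sum_smul, G.sum_laplacian_col]

theorem kronApply_laplacian_consensus (G : WeightedGraph N) (x : Profile n) :
    kronApply G.laplacian (consensus x) = 0 := by
  refine PiLp.ext fun i => ?_
  simp [kronApply, consensus, ← Finset.sum_smul, G.sum_laplacian_row]

theorem inner_consensus (X : Aug n) (y : Profile n) :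
    inner ℝ X (consensus y) = N * inner ℝ (average X) y := by
  rcases Nat.eq_zero_or_pos N with rfl | hN
  · simp [PiLp.inner_apply]
  have : (N : ℝ) ≠ 0 := by positivity
  rw [average, inner_smul_left, sum_inner, PiLp.inner_apply, conj_trivial, ← mul_assoc,
    mul_inv_cancel₀ this, one_mul]
  rfl

/-- `L ⊗ I_n` acts on each scalar coordinate separately, and each coordinate has zero sum over the
agents. -/
theorem lambda2_mul_norm_sq_le (G : WeightedGraph N) (hN : 2 ≤ N) {X : Aug n}
    (hX : average X = 0) :
    G.lambda2 hN * ‖X‖ ^ 2 ≤ inner ℝ X (kronApply G.laplacian X) := by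
  have hN0 : (N : ℝ)⁻¹ ≠ 0 := by
    have : (N : ℝ) ≠ 0 := by norm_cast; omega
    exact inv_ne_zero this
  have hsum : ∑ i, X i = 0 := (smul_eq_zero.mp hX).resolve_left hN0
  have h1 : ‖X‖ ^ 2 = ∑ j, ∑ k, ∑ i, (X i j k) ^ 2 := by
    rw [norm_sq_aug]
    simp_rw [PiLp.norm_sq_eq_of_L2, Real.norm_eq_abs, sq_abs]
    rw [Finset.sum_comm]
    refine Finset.sum_congr rfl fun j _ => Finset.sum_comm
  have h2 : inner ℝ X (kronApply G.laplacian X)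
      = ∑ j, ∑ k, ∑ i, ∑ l, G.laplacian i l * (X i j k * X l j k) := by
    simp only [PiLp.inner_apply, kronApply, WithLp.ofLp_sum, Finset.sum_apply, WithLp.ofLp_smul,
      Pi.smul_apply, smul_eq_mul, RCLike.inner_apply, conj_trivial, Finset.sum_mul]
    rw [Finset.sum_comm]
    refine Finset.sum_congr rfl fun j _ => ?_
    rw [Finset.sum_comm]
    refine Finset.sum_congr rfl fun k _ => Finset.sum_congr rfl fun i _ =>
      Finset.sum_congr rfl fun l _ => by ring
  rw [h1, h2, Finset.mul_sum]
  refine Finset.sum_le_sum fun j _ => ?_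
  rw [Finset.mul_sum]
  refine Finset.sum_le_sum fun k _ => ?_
  refine G.lambda2_mul_le hN (fun i => X i j k) ?_
  have := congrArg (fun z : Profile n => z j k) hsum
  simpa using this

end Game

/-! ### Lyapunov analysis of the dynamics -/

section Convergence

variable {N : ℕ} {n : Fin N → ℕ}

/-- The disagreement part of a stacked vector, as a continuous linear map. -/
noncomputable def perpCLM : Aug n →L[ℝ] Aug n :=
  ContinuousLinearMap.id ℝ (Aug n) - consensusCLM.comp averageCLM

/-- The disagreement part of a stacked vector. -/
noncomputable def perp (X : Aug n) : Aug n := X - consensus (average X)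

theorem perp_add_consensus (X : Aug n) : perp X + consensus (average X) = X := by simp [perp]

theorem average_perp (hN : N ≠ 0) (X : Aug n) : average (perp X) = 0 := by
  have h := (averageCLM (n := n)).map_sub X (consensus (average X))
  simp only [averageCLM_apply] at h
  rw [perp, h, average_consensus hN, sub_self]

theorem inner_perp_consensus (hN : N ≠ 0) (X : Aug n) (y : Profile n) :
    inner ℝ (perp X) (consensus y) = 0 := by
  rw [inner_consensus, average_perp hN, inner_zero_left, mul_zero]

theorem inner_perp_perp (hN : N ≠ 0) (X Y : Aug n) :
    inner ℝ (perp X) (perp Y) = inner ℝ (perp X) Y := by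
  nth_rewrite 2 [← perp_add_consensus Y]
  rw [inner_add_right, inner_perp_consensus hN, add_zero]

/-- The right-hand side of the equation for `𝐱`. -/
noncomputable def field (J : Fin N → Profile n → ℝ) (G : WeightedGraph N) (β c : ℝ)
    (X r : Aug n) : Aug n :=
  -embedOwn (extPseudoGradient J X) - β • (X - r) - c • kronApply G.laplacian X

theorem average_field (J : Fin N → Profile n → ℝ) (G : WeightedGraph N) (β c : ℝ)
    (X r : Aug n) :
    average (field J G β c X r)
      = -((N : ℝ)⁻¹ • extPseudoGradient J X) - β • (average X - average r) := by
  simp only [field, ← averageCLM_apply, map_sub, map_neg, map_smul]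
  simp only [averageCLM_apply, average_embedOwn, average_kronApply_laplacian, smul_zero, sub_zero]

theorem norm_extPseudoGradient_sub_average_le {J : Fin N → Profile n → ℝ} {L_F : ℝ≥0}
    (hLip : LipschitzWith L_F (pseudoGradient J)) (X : Aug n) :
    ‖extPseudoGradient J X - pseudoGradient J (average X)‖ ≤ L_F * ‖perp X‖ := by
  rw [← extPseudoGradient_consensus]
  exact norm_extPseudoGradient_sub_le hLip _ _

variable {J : Fin N → Profile n → ℝ} {G : WeightedGraph N} {Jr : Profile n → Profile n}
  {xs : Profile n} {L_F : ℝ≥0} {μ d α β c LJ κ : ℝ}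

theorem norm_average_sub_le (hres : IsResolvent (pseudoGradient J) Jr (1 / (β * N)) LJ κ xs)
    (x r : Profile n) : ‖x - xs‖ ≤ ‖x - Jr r‖ + LJ * ‖r - xs‖ := by
  have h1 := hres.lip r xs
  rw [hres.fix] at h1
  have h2 : x - xs = (x - Jr r) + (Jr r - xs) := by abel
  rw [h2]
  exact (norm_add_le _ _).trans (by linarith)

/-- The Laplacian supplies the damping `c λ₂`. The gradient term is compared with `F(x̄)` and then
with `F(x*) = 0`, the distance from `x̄` to `x*` being measured through `𝒥 r̄`. -/
theorem inner_perp_field_le (hN : 2 ≤ N) (hLip : LipschitzWith L_F (pseudoGradient J))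
    (hres : IsResolvent (pseudoGradient J) Jr (1 / (β * N)) LJ κ xs) (hc : 0 ≤ c)
    (X r : Aug n) :
    inner ℝ (perp X) (field J G β c X r) ≤
      L_F * ‖perp X‖ * (‖perp X‖ + ‖average X - Jr (average r)‖ + LJ * ‖average r - xs‖)
        - c * G.lambda2 hN * ‖perp X‖ ^ 2 - β * inner ℝ (perp X) (perp X - perp r) := by
  have hN0 : N ≠ 0 := by omega
  have hlap : kronApply G.laplacian X = kronApply G.laplacian (perp X) := by
    have := (kronCLM (n := n) G.laplacian).map_add (perp X) (consensus (average X))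
    simp only [kronCLM_apply, kronApply_laplacian_consensus, add_zero, perp_add_consensus] at this
    exact this
  have hlam := mul_le_mul_of_nonneg_left
    (lambda2_mul_norm_sq_le G hN (average_perp hN0 X)) hc
  have hF : ‖extPseudoGradient J X‖ ≤
      L_F * (‖perp X‖ + ‖average X - Jr (average r)‖ + LJ * ‖average r - xs‖) := by
    have h1 := norm_extPseudoGradient_sub_average_le hLip X
    have h2 : ‖pseudoGradient J (average X)‖ ≤ L_F * ‖average X - xs‖ := by
      have := hLip.dist_le_mul (average X) xs
      rwa [dist_eq_norm, dist_eq_norm, hres.zero, sub_zero] at this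
    have h3 := mul_le_mul_of_nonneg_left (norm_average_sub_le hres (average X) (average r)) L_F.2
    have h4 := norm_le_norm_add_norm_sub' (extPseudoGradient J X) (pseudoGradient J (average X))
    change (L_F : ℝ) * _ ≤ (L_F : ℝ) * _ at h3
    linarith
  have hemb : -inner ℝ (perp X) (embedOwn (extPseudoGradient J X))
      ≤ ‖perp X‖ * ‖extPseudoGradient J X‖ := by
    have := neg_le_of_abs_le (abs_real_inner_le_norm (perp X) (embedOwn (extPseudoGradient J X)))
    rw [norm_embedOwn] at this
    linarith
  have hXr : inner ℝ (perp X) (X - r) = inner ℝ (perp X) (perp X - perp r) := by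
    rw [inner_sub_right, inner_sub_right, inner_perp_perp hN0, inner_perp_perp hN0]
  rw [field, inner_sub_right, inner_sub_right, inner_neg_right, inner_smul_right,
    inner_smul_right, hXr, hlap]
  have := mul_le_mul_of_nonneg_left hF (norm_nonneg (perp X))
  linarith

/-- The resolvent identity `F(𝒥 r̄)/N = β(r̄ - 𝒥 r̄)` turns the averaged field into increments of
`F` minus `β(x̄ - 𝒥 r̄)`; hypomonotonicity then costs only `μ/N` of the damping `β`. -/
theorem inner_tracking_field_le (hN : N ≠ 0) (hβ : β ≠ 0)
    (hLip : LipschitzWith L_F (pseudoGradient J)) (hHypo : Hypomonotone μ (pseudoGradient J))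
    (hres : IsResolvent (pseudoGradient J) Jr (1 / (β * N)) LJ κ xs) (X r : Aug n) :
    inner ℝ (average X - Jr (average r)) (average (field J G β c X r)) ≤
      -(β - μ / N) * ‖average X - Jr (average r)‖ ^ 2
        + (N : ℝ)⁻¹ * (L_F * ‖average X - Jr (average r)‖ * ‖perp X‖) := by
  have hN' : (N : ℝ) ≠ 0 := by exact_mod_cast hN
  have hN0 : (0 : ℝ) ≤ (N : ℝ)⁻¹ := by positivity
  set w := average X - Jr (average r) with hw
  have hFJ : (N : ℝ)⁻¹ • pseudoGradient J (Jr (average r)) = β • (average r - Jr (average r)) := by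
    have h1 := hres.eq (average r)
    have h2 : average r - Jr (average r)
        = (1 / (β * N)) • pseudoGradient J (Jr (average r)) := by
      nth_rewrite 1 [← h1]; abel
    rw [h2, smul_smul]
    congr 1
    field_simp
  have hfield : average (field J G β c X r)
      = -((N : ℝ)⁻¹ • (extPseudoGradient J X - pseudoGradient J (average X)))
        - (N : ℝ)⁻¹ • (pseudoGradient J (average X) - pseudoGradient J (Jr (average r)))
        - β • w := by
    rw [average_field, hw]
    simp only [smul_sub] at hFJ ⊢
    rw [hFJ]
    abel
  have h1 : -(‖w‖ * (L_F * ‖perp X‖))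
      ≤ inner ℝ w (extPseudoGradient J X - pseudoGradient J (average X)) :=
    (neg_le_neg (mul_le_mul_of_nonneg_left (norm_extPseudoGradient_sub_average_le hLip X)
      (norm_nonneg w))).trans (neg_le_of_abs_le (abs_real_inner_le_norm _ _))
  have h2 := hHypo (average X) (Jr (average r))
  rw [real_inner_comm] at h2
  have h1' := mul_le_mul_of_nonneg_left h1 hN0
  have h2' := mul_le_mul_of_nonneg_left h2 hN0
  rw [hfield, inner_sub_right, inner_sub_right, inner_neg_right, inner_smul_right,
    inner_smul_right, inner_smul_right, real_inner_self_eq_norm_sq]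
  rw [← hw] at h2'
  have h3 : μ / N = (N : ℝ)⁻¹ * μ := by ring
  rw [h3]
  linarith

theorem inner_anchor_le (hres : IsResolvent (pseudoGradient J) Jr (1 / (β * N)) LJ κ xs)
    (x r : Profile n) :
    inner ℝ (r - xs) (x - r) ≤ -(1 - κ) * ‖r - xs‖ ^ 2 + ‖r - xs‖ * ‖x - Jr r‖ := by
  have h1 := hres.inner_le r xs
  rw [hres.fix, real_inner_comm] at h1
  have h2 : x - r = (x - Jr r) + (Jr r - xs) - (r - xs) := by abel
  have h3 := real_inner_le_norm (r - xs) (x - Jr r)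
  rw [h2, inner_sub_right, inner_add_right, real_inner_self_eq_norm_sq]
  linarith

theorem norm_resolvent_sub_le (hres : IsResolvent (pseudoGradient J) Jr (1 / (β * N)) LJ κ xs)
    (r : Profile n) : ‖Jr r - r‖ ≤ (1 + LJ) * ‖r - xs‖ := by
  have h1 := hres.lip r xs
  rw [hres.fix] at h1
  have h2 : Jr r - r = (Jr r - xs) - (r - xs) := by abel
  rw [h2]
  exact (norm_sub_le _ _).trans (by linarith)

/-- The Lyapunov function. -/
noncomputable def lyapunov (Jr : Profile n → Profile n) (xs : Profile n) (d α β : ℝ)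
    (X r : Aug n) : ℝ :=
  (1 - d) * N * (‖average r - xs‖ ^ 2 / 2) + ‖perp X‖ ^ 2 / 2 + β / α * (‖perp r‖ ^ 2 / 2)
    + d * N * (‖average X - Jr (average r)‖ ^ 2 / 2)

/-- The upper bound on the right Dini derivative of the Lyapunov function along the dynamics. -/
noncomputable def lyapunovRate (J : Fin N → Profile n → ℝ) (G : WeightedGraph N)
    (Jr : Profile n → Profile n) (xs : Profile n) (d α β c LJ : ℝ) (X r : Aug n) : ℝ :=
  (1 - d) * N * inner ℝ (average r - xs) (α • (average X - average r))
    + inner ℝ (perp X) (field J G β c X r)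
    + β / α * inner ℝ (perp r) (α • (X - r))
    + d * N * (inner ℝ (average X - Jr (average r)) (average (field J G β c X r))
      + LJ * ‖average X - Jr (average r)‖ * (α * ‖Jr (average r) - average r‖))

theorem det_Phi (d α β m LJ κ : ℝ) :
    (Phi d α β m LJ κ).det = (1 - d) * α * (1 - κ) * (d * (β - m))
      - (-((α + α * (LJ ^ 2 + LJ - 1) * d) / 2)) ^ 2 := by
  rw [Phi, Matrix.det_fin_two_of]; ring

/-- Since `1 + (LJ² + LJ - 1)d = (1 - d) + d(LJ + LJ²)`, positivity of the determinant is the bound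
on `α` multiplied by `α`. -/
theorem det_Phi_pos {m : ℝ} (hd0 : 0 < d) (hd1 : d < 1) (hα0 : 0 < α) (hLJ : 0 ≤ LJ)
    (hα1 : α < 4 * d * (1 - d) * (β - m) * (1 - κ) / ((1 - d) + d * (LJ + LJ ^ 2)) ^ 2) :
    0 < (Phi d α β m LJ κ).det := by
  have hden : 0 < (1 - d) + d * (LJ + LJ ^ 2) := by
    have : 0 ≤ d * (LJ + LJ ^ 2) := by positivity
    linarith
  rw [lt_div_iff₀ (by positivity)] at hα1
  rw [det_Phi]
  have := mul_lt_mul_of_pos_left hα1 hα0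
  nlinarith

theorem exists_lyapunovRate_le (hN : 2 ≤ N)
    (hLip : LipschitzWith L_F (pseudoGradient J)) (hHypo : Hypomonotone μ (pseudoGradient J))
    (hd0 : 0 < d) (hd1 : d < 1) (hα0 : 0 < α) (hβ : 0 < β) (hβμ : μ / N < β)
    (hLJ : 0 ≤ LJ) (hκ : κ < 1) (hc0 : 0 ≤ c)
    (hres : IsResolvent (pseudoGradient J) Jr (1 / (β * N)) LJ κ xs)
    (hdet : 0 < (Phi d α β (μ / N) LJ κ).det)
    (hc : c * G.lambda2 hN >
      (eta1 N d α β (μ / N) LJ κ + eta2 N d α LJ) / (4 * (Phi d α β (μ / N) LJ κ).det)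
        * (L_F : ℝ) ^ 2 + L_F) :
    ∃ δ > 0, ∀ X r : Aug n,
      lyapunovRate J G Jr xs d α β c LJ X r ≤ -δ * lyapunov Jr xs d α β X r := by
  have hNpos : (0 : ℝ) < N := by norm_cast; omega
  have hsN : 0 < Real.sqrt N := Real.sqrt_pos.mpr hNpos
  have hsN1 : 1 ≤ Real.sqrt N := Real.one_le_sqrt.mpr (by norm_cast; omega)
  have hsq : Real.sqrt N ^ 2 = N := Real.sq_sqrt hNpos.le
  have hLF : (0 : ℝ) ≤ L_F := L_F.2
  rw [det_Phi] at hdet hc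
  obtain ⟨o, ho⟩ : ∃ o, o = -((α + α * (LJ ^ 2 + LJ - 1) * d) / 2) := ⟨_, rfl⟩
  obtain ⟨p₁, hp₁⟩ : ∃ p₁, p₁ = (1 - d) * α * (1 - κ) := ⟨_, rfl⟩
  obtain ⟨p₂, hp₂⟩ : ∃ p₂, p₂ = d * (β - μ / N) := ⟨_, rfl⟩
  rw [← ho, ← hp₁, ← hp₂] at hdet hc
  have hp₁0 : 0 < p₁ := hp₁ ▸ mul_pos (mul_pos (by linarith) hα0) (by linarith)
  have hp₂0 : 0 < p₂ := hp₂ ▸ mul_pos hd0 (by linarith)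
  -- With these coefficients the three terms of the Schur numerator are `L_F²` times the second part
  -- of `η₁`, then `η₂`, then the first part of `η₁`.
  obtain ⟨ε, hε, hQ⟩ := exists_quadratic_form_lower_bound (o := o) (u := L_F * LJ)
    (v := L_F * (1 + d / Real.sqrt N)) (s := c * G.lambda2 hN - L_F) hp₁0 hp₂0 hdet (by
      have : p₂ * (L_F * LJ) ^ 2 - 2 * o * (L_F * LJ) * (L_F * (1 + d / Real.sqrt N))
          + p₁ * (L_F * (1 + d / Real.sqrt N)) ^ 2
          = (eta1 N d α β (μ / N) LJ κ + eta2 N d α LJ) * (L_F : ℝ) ^ 2 := by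
        rw [eta1, eta2, hp₁, hp₂, ho]; ring
      rw [this, ← div_mul_eq_mul_div]
      linarith)
  obtain ⟨ν, hν⟩ : ∃ ν, ν = min ε β := ⟨_, rfl⟩
  have hν0 : 0 < ν := hν ▸ lt_min hε hβ
  have hα' : 0 < β / α := div_pos hβ hα0
  obtain ⟨M, hM⟩ : ∃ M, M = 1 + β / α := ⟨_, rfl⟩
  have hM0 : 0 < M := by rw [hM]; positivity
  -- `M` dominates the weights of the Lyapunov function after the `√N` scaling. The form gives no
  -- decay in `r⊥` directly; it is recovered from `‖r⊥‖² ≤ 2‖x⊥‖² + 2‖x⊥ - r⊥‖²`.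
  refine ⟨ν / (2 * M), by positivity, fun X r => ?_⟩
  set A := ‖average r - xs‖ with hA
  set B := ‖average X - Jr (average r)‖ with hB
  set e := ‖perp X‖ with he
  set f := ‖perp r‖ with hf
  set g := ‖perp X - perp r‖ with hg
  have hA0 : 0 ≤ A := norm_nonneg _
  have hB0 : 0 ≤ B := norm_nonneg _
  have he0 : 0 ≤ e := norm_nonneg _
  have h1 := inner_anchor_le hres (average X) (average r)
  have h2 := inner_perp_field_le (G := G) hN hLip hres hc0 X r
  have h3 := inner_tracking_field_le (G := G) (c := c) (by omega) hβ.ne' hLip hHypo hres X r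
  have h4 := norm_resolvent_sub_le hres (average r)
  rw [← hA, ← hB] at h1
  rw [← hA, ← hB, ← he] at h2
  rw [← hB, ← he] at h3
  rw [← hA] at h4
  have hperp : inner ℝ (perp r) (X - r) = inner ℝ (perp r) (perp X - perp r) := by
    rw [inner_sub_right, inner_sub_right, inner_perp_perp (by omega), inner_perp_perp (by omega)]
  have hgsq : inner ℝ (perp r) (perp X - perp r) - inner ℝ (perp X) (perp X - perp r)
      = -g ^ 2 := by
    rw [← inner_sub_left, ← neg_sub, inner_neg_left, real_inner_self_eq_norm_sq]
  have hfg : f ^ 2 ≤ 2 * e ^ 2 + 2 * g ^ 2 := by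
    have : f ≤ e + g := by
      have h := norm_sub_le (perp X) (perp X - perp r)
      rwa [sub_sub_cancel] at h
    have := pow_le_pow_left₀ (norm_nonneg (perp r)) this 2
    linarith only [this, sq_nonneg (e - g)]
  obtain ⟨i₁, hi₁⟩ : ∃ i, i = inner ℝ (perp r) (perp X - perp r) := ⟨_, rfl⟩
  obtain ⟨i₂, hi₂⟩ : ∃ i, i = inner ℝ (perp X) (perp X - perp r) := ⟨_, rfl⟩
  rw [← hi₁, ← hi₂] at hgsq
  rw [← hi₁] at hperp
  rw [← hi₂] at h2
  have hratedef : lyapunovRate J G Jr xs d α β c LJ X r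
      = (1 - d) * N * (α * inner ℝ (average r - xs) (average X - average r))
        + inner ℝ (perp X) (field J G β c X r) + β / α * (α * i₁)
        + d * N * (inner ℝ (average X - Jr (average r)) (average (field J G β c X r))
          + LJ * B * (α * ‖Jr (average r) - average r‖)) := by
    rw [lyapunovRate, inner_smul_right, inner_smul_right, hperp]
  have hlyap : lyapunov Jr xs d α β X r = (1 - d) * N * (A ^ 2 / 2) + e ^ 2 / 2
      + β / α * (f ^ 2 / 2) + d * N * (B ^ 2 / 2) := rfl
  clear_value A B e f g
  generalize inner ℝ (average r - xs) (average X - average r) = j₁ at h1 hratedef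
  generalize inner ℝ (perp X) (field J G β c X r) = j₂ at h2 hratedef
  generalize inner ℝ (average X - Jr (average r)) (average (field J G β c X r)) = j₃ at h3 hratedef
  generalize ‖Jr (average r) - average r‖ = q at h4 hratedef
  have hrate : lyapunovRate J G Jr xs d α β c LJ X r ≤
      -(p₁ * (Real.sqrt N * A) ^ 2 + 2 * o * (Real.sqrt N * A) * (Real.sqrt N * B)
        + p₂ * (Real.sqrt N * B) ^ 2 - L_F * LJ * (Real.sqrt N * A) * e
        - L_F * (1 + d / Real.sqrt N) * (Real.sqrt N * B) * e
        + (c * G.lambda2 hN - L_F) * e ^ 2) - β * g ^ 2 := by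
    have t1 := mul_le_mul_of_nonneg_left h1
      (by have : 0 ≤ 1 - d := by linarith
          positivity : 0 ≤ (1 - d) * N * α)
    have t3 := mul_le_mul_of_nonneg_left h3 (by positivity : 0 ≤ d * N)
    have t4 := mul_le_mul_of_nonneg_left h4 (by positivity : 0 ≤ d * N * (LJ * B * α))
    have hNinv : d * N * ((N : ℝ)⁻¹ * (L_F * B * e)) = d * (L_F * B * e) := by
      field_simp
    have hdiv : L_F * (1 + d / Real.sqrt N) * (Real.sqrt N * B) * e
        = L_F * (Real.sqrt N * B) * e + d * (L_F * B * e) := by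
      field_simp
    -- The disagreement estimate yields unscaled couplings; `√N ≥ 1` brings them to the variables in
    -- which the diagonal terms carry no factor `N`.
    have t5 : L_F * B * e ≤ L_F * (Real.sqrt N * B) * e := by
      have : B ≤ Real.sqrt N * B := le_mul_of_one_le_left hB0 hsN1
      gcongr
    have t6 : L_F * LJ * A * e ≤ L_F * LJ * (Real.sqrt N * A) * e := by
      have : A ≤ Real.sqrt N * A := le_mul_of_one_le_left hA0 hsN1
      gcongr
    have e1 : (Real.sqrt N * A) ^ 2 = N * A ^ 2 := by rw [mul_pow, hsq]
    have e2 : (Real.sqrt N * B) ^ 2 = N * B ^ 2 := by rw [mul_pow, hsq]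
    have e3 : 2 * o * (Real.sqrt N * A) * (Real.sqrt N * B) = 2 * o * (N * (A * B)) := by
      linear_combination 2 * o * A * B * hsq
    have e4 : β / α * (α * i₁) = β * i₁ := by field_simp
    have hg' : β * i₁ = β * i₂ - β * g ^ 2 := by
      have := congrArg (β * ·) hgsq
      simp only [mul_sub] at this
      linarith
    rw [hdiv, e1, e2, e3, hratedef, e4, hg', ho, hp₁, hp₂]
    rw [mul_add, hNinv] at t3
    linarith only [t1, t3, t4, t5, t6, h2]
  have hQ' := hQ (Real.sqrt N * A) (Real.sqrt N * B) e
  have hνε : ν ≤ ε := hν ▸ min_le_left _ _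
  have hνβ : ν ≤ β := hν ▸ min_le_right _ _
  have hV : lyapunov Jr xs d α β X r
      ≤ M * ((Real.sqrt N * A) ^ 2 / 2 + (Real.sqrt N * B) ^ 2 / 2 + e ^ 2 / 2 + f ^ 2 / 2) := by
    have e1 : (Real.sqrt N * A) ^ 2 = N * A ^ 2 := by rw [mul_pow, hsq]
    have e2 : (Real.sqrt N * B) ^ 2 = N * B ^ 2 := by rw [mul_pow, hsq]
    rw [hlyap, e1, e2, hM]
    have q1 : 0 ≤ N * A ^ 2 := by positivity
    have q2 : 0 ≤ N * B ^ 2 := by positivity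
    have q3 : 0 ≤ β / α * (N * A ^ 2) := by positivity
    have q4 : 0 ≤ β / α * (N * B ^ 2) := by positivity
    have q5 : 0 ≤ β / α * e ^ 2 := by positivity
    linarith only [q1, q2, q3, q4, q5, sq_nonneg f, sq_nonneg e, mul_nonneg hd0.le q1,
      mul_nonneg (sub_nonneg.mpr hd1.le) q2]
  have hδV : ν / (2 * M) * lyapunov Jr xs d α β X r
      ≤ ν / 4 * ((Real.sqrt N * A) ^ 2 + (Real.sqrt N * B) ^ 2 + e ^ 2 + f ^ 2) := by
    refine (mul_le_mul_of_nonneg_left hV (by positivity)).trans (le_of_eq ?_)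
    field_simp
    ring
  have s1 := mul_le_mul_of_nonneg_right hνε
    (by positivity : 0 ≤ (Real.sqrt N * A) ^ 2 + (Real.sqrt N * B) ^ 2 + e ^ 2)
  have s2 := mul_le_mul_of_nonneg_right hνβ (sq_nonneg g)
  have s3 := mul_le_mul_of_nonneg_left hfg hν0.le
  have s4 : 0 ≤ ν * ((Real.sqrt N * A) ^ 2 + (Real.sqrt N * B) ^ 2) := by positivity
  have s5 : 0 ≤ ν * e ^ 2 := by positivity
  have s6 : 0 ≤ ν * g ^ 2 := by positivity
  linarith

/-- Right Dini derivative of the sum of a differentiable function and a function with a bound on its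
right Dini derivative. -/
theorem eventually_slope_add_mul_lt {S W : ℝ → ℝ} {S' D k ρ t : ℝ} (hk : 0 < k)
    (hS : HasDerivWithinAt S S' (Set.Ioi t) t)
    (hW : ∀ ρ', D < ρ' → ∀ᶠ z in 𝓝[>] t, (z - t)⁻¹ * (W z - W t) < ρ') (hρ : S' + k * D < ρ) :
    ∀ᶠ z in 𝓝[>] t, (z - t)⁻¹ * ((S z + k * W z) - (S t + k * W t)) < ρ := by
  obtain ⟨η, hη⟩ : ∃ η, η = (ρ - (S' + k * D)) / 2 := ⟨_, rfl⟩
  have hη0 : 0 < η := by rw [hη]; linarith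
  filter_upwards [((hasDerivWithinAt_iff_tendsto_slope' (by simp)).mp hS).eventually
    (gt_mem_nhds (lt_add_of_pos_right S' hη0)),
    hW (D + η / k) (lt_add_of_pos_right D (by positivity))] with z hz1 hz2
  rw [slope_def_module, smul_eq_mul] at hz1
  have hz2' := mul_lt_mul_of_pos_left hz2 hk
  rw [mul_add, mul_div_cancel₀ η hk.ne'] at hz2'
  linarith

/-- The Lyapunov function has right Dini derivative at most `lyapunovRate` along solutions. -/
theorem eventually_slope_lyapunov_lt (hα0 : 0 < α) (hN : 2 ≤ N) (hd0 : 0 < d)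
    (hres : IsResolvent (pseudoGradient J) Jr (1 / (β * N)) LJ κ xs)
    {X r : ℝ → Aug n} (hsol : IsSolution J G α β c X r) {t : ℝ} (ht : 0 ≤ t) {ρ : ℝ}
    (hρ : lyapunovRate J G Jr xs d α β c LJ (X t) (r t) < ρ) :
    ∀ᶠ z in 𝓝[>] t, (z - t)⁻¹ *
      (lyapunov Jr xs d α β (X z) (r z) - lyapunov Jr xs d α β (X t) (r t)) < ρ := by
  have hNpos : (0 : ℝ) < N := by norm_cast; omega
  have hN0 : N ≠ 0 := by omega
  have hsub : Set.Ioi t ⊆ Set.Ici 0 := fun z hz => ht.trans (le_of_lt hz)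
  have hr := (hsol t ht).1.mono hsub
  have hX : HasDerivWithinAt X (field J G β c (X t) (r t)) (Set.Ioi t) t :=
    (hsol t ht).2.mono hsub
  have hra : HasDerivWithinAt (fun s => average (r s)) (α • (average (X t) - average (r t)))
      (Set.Ioi t) t := by
    have h1 : HasDerivWithinAt (fun s => average (r s)) (averageCLM (α • (X t - r t)))
        (Set.Ioi t) t := (averageCLM (n := n)).hasFDerivAt.comp_hasDerivWithinAt t hr
    rw [map_smul, map_sub] at h1
    exact h1
  have hXa : HasDerivWithinAt (fun s => average (X s)) (average (field J G β c (X t) (r t)))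
      (Set.Ioi t) t := (averageCLM (n := n)).hasFDerivAt.comp_hasDerivWithinAt t hX
  have hXp : HasDerivWithinAt (fun s => perp (X s)) (perp (field J G β c (X t) (r t)))
      (Set.Ioi t) t := (perpCLM (n := n)).hasFDerivAt.comp_hasDerivWithinAt t hX
  have hrp : HasDerivWithinAt (fun s => perp (r s)) (perp (α • (X t - r t)))
      (Set.Ioi t) t := (perpCLM (n := n)).hasFDerivAt.comp_hasDerivWithinAt t hr
  have hS := (((hra.sub_const xs).norm_sq.div_const 2).const_mul ((1 - d) * N)).add
    (hXp.norm_sq.div_const 2) |>.add ((hrp.norm_sq.div_const 2).const_mul (β / α))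
  simp only [mul_div_cancel_left₀ _ (two_ne_zero' ℝ), inner_perp_perp hN0] at hS
  set S' := (1 - d) * N * inner ℝ (average (r t) - xs) (α • (average (X t) - average (r t)))
    + inner ℝ (perp (X t)) (field J G β c (X t) (r t))
    + β / α * inner ℝ (perp (r t)) (α • (X t - r t)) with hS'
  set D := inner ℝ (average (X t) - Jr (average (r t))) (average (field J G β c (X t) (r t)))
      + LJ * ‖average (X t) - Jr (average (r t))‖ * (α * ‖Jr (average (r t)) - average (r t)‖)
    with hD
  refine eventually_slope_add_mul_lt (D := D) (by positivity : 0 < d * N) hS (fun ρ' hρ' => ?_) hρ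
  -- Here `r̄' = α((x̄ - 𝒥 r̄) + (𝒥 r̄ - r̄))`, whose first part is the direction handled by
  -- monotonicity.
  exact eventually_slope_half_norm_sq_lt (q := Jr (average (r t)) - average (r t)) hα0.le
    hres.lip hres.mono hXa (by rw [sub_add_sub_cancel]; exact hra) hρ'

/-- A nonnegative function whose right Dini derivative is at most `-δ` times itself tends to `0`. -/
theorem tendsto_zero_of_dini {V : ℝ → ℝ} {δ : ℝ} (hδ : 0 < δ) (hV0 : ∀ t, 0 ≤ V t)
    (hcont : ContinuousOn V (Set.Ici 0))
    (hV : ∀ t, 0 ≤ t → ∀ ρ, -δ * V t < ρ → ∀ᶠ z in 𝓝[>] t, (z - t)⁻¹ * (V z - V t) < ρ) :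
    Tendsto V atTop (𝓝 0) := by
  have hbound : ∀ t, 0 ≤ t → V t ≤ V 0 * Real.exp (-δ * t) := by
    intro t ht
    have := le_gronwallBound_of_liminf_deriv_right_le (f := V) (f' := fun s => -δ * V s)
      (δ := V 0) (K := -δ) (ε := 0) (a := 0) (b := t)
      (hcont.mono Set.Icc_subset_Ici_self) (fun s hs ρ hρ => (hV s hs.1 ρ hρ).frequently) le_rfl
      (fun s _ => by simp) t ⟨ht, le_rfl⟩
    rwa [gronwallBound_ε0, sub_zero] at this
  have hexp : Tendsto (fun t => V 0 * Real.exp (-δ * t)) atTop (𝓝 0) := by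
    have h1 : Tendsto (fun t : ℝ => -δ * t) atTop atBot :=
      tendsto_id.const_mul_atTop_of_neg (neg_neg_of_pos hδ)
    simpa using (Real.tendsto_exp_atBot.comp h1).const_mul (V 0)
  exact tendsto_of_tendsto_of_tendsto_of_le_of_le' tendsto_const_nhds hexp
    (Eventually.of_forall hV0) ((eventually_ge_atTop 0).mono hbound)

theorem tendsto_of_norm_sq_le {E ι : Type*} [NormedAddCommGroup E] {l : Filter ι} {u : ι → E}
    {V : ι → ℝ} {k : ℝ} (hk : 0 < k) (hV : Tendsto V l (𝓝 0))
    (hu : ∀ t, k * (‖u t‖ ^ 2 / 2) ≤ V t) : Tendsto u l (𝓝 0) := by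
  have h1 : Tendsto (fun t => ‖u t‖ ^ 2) l (𝓝 0) := by
    refine squeeze_zero (g := fun t => 2 / k * V t) (fun t => sq_nonneg _) (fun t => ?_)
      (by simpa using hV.const_mul (2 / k))
    rw [div_mul_eq_mul_div, le_div_iff₀ hk]
    linarith [hu t]
  rw [tendsto_zero_iff_norm_tendsto_zero]
  simpa [Real.sqrt_sq] using h1.sqrt

theorem tendsto_of_isSolution (hN : 2 ≤ N) (hd0 : 0 < d) (hd1 : d < 1) (hα0 : 0 < α) (hβ : 0 < β)
    (hres : IsResolvent (pseudoGradient J) Jr (1 / (β * N)) LJ κ xs) {δ : ℝ} (hδ : 0 < δ)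
    (hrate : ∀ X r : Aug n,
      lyapunovRate J G Jr xs d α β c LJ X r ≤ -δ * lyapunov Jr xs d α β X r)
    {X r : ℝ → Aug n} (hsol : IsSolution J G α β c X r) :
    Tendsto X atTop (𝓝 (consensus xs)) ∧ Tendsto r atTop (𝓝 (consensus xs)) := by
  have hNpos : (0 : ℝ) < N := by norm_cast; omega
  have hd1' : 0 < 1 - d := by linarith
  have hJc : Continuous Jr := by
    refine LipschitzWith.continuous (K := LJ.toNNReal) (LipschitzWith.of_dist_le_mul fun x y => ?_)
    rw [dist_eq_norm, dist_eq_norm]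
    exact (hres.lip x y).trans
      (mul_le_mul_of_nonneg_right (Real.le_coe_toNNReal LJ) (norm_nonneg _))
  have hXc : ContinuousOn X (Set.Ici 0) := fun t ht => (hsol t ht).2.continuousWithinAt
  have hrc : ContinuousOn r (Set.Ici 0) := fun t ht => (hsol t ht).1.continuousWithinAt
  have hXa : ContinuousOn (fun t => average (X t)) (Set.Ici 0) :=
    (averageCLM (n := n)).continuous.comp_continuousOn hXc
  have hra : ContinuousOn (fun t => average (r t)) (Set.Ici 0) :=
    (averageCLM (n := n)).continuous.comp_continuousOn hrc
  have hXp : ContinuousOn (fun t => perp (X t)) (Set.Ici 0) :=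
    (perpCLM (n := n)).continuous.comp_continuousOn hXc
  have hrp : ContinuousOn (fun t => perp (r t)) (Set.Ici 0) :=
    (perpCLM (n := n)).continuous.comp_continuousOn hrc
  have hJra : ContinuousOn (fun t => Jr (average (r t))) (Set.Ici 0) :=
    hJc.comp_continuousOn hra
  have hV : Tendsto (fun t => lyapunov Jr xs d α β (X t) (r t)) atTop (𝓝 0) := by
    refine tendsto_zero_of_dini hδ (fun t => ?_) ?_ fun t ht ρ hρ =>
      eventually_slope_lyapunov_lt hα0 hN hd0 hres hsol ht ((hrate _ _).trans_lt hρ)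
    · unfold lyapunov; positivity
    · unfold lyapunov; fun_prop
  have c1 : 0 < (1 - d) * N := by positivity
  have c2 : 0 < β / α := by positivity
  have c3 : 0 < d * N := by positivity
  have hsplit : ∀ t, 0 ≤ (1 - d) * N * (‖average (r t) - xs‖ ^ 2 / 2) ∧ 0 ≤ ‖perp (X t)‖ ^ 2 / 2 ∧
      0 ≤ β / α * (‖perp (r t)‖ ^ 2 / 2) ∧
      0 ≤ d * N * (‖average (X t) - Jr (average (r t))‖ ^ 2 / 2) := fun t =>
    ⟨by positivity, by positivity, by positivity, by positivity⟩
  have l1 : Tendsto (fun t => average (r t) - xs) atTop (𝓝 0) :=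
    tendsto_of_norm_sq_le c1 hV fun t => by
      obtain ⟨a1, a2, a3, a4⟩ := hsplit t; unfold lyapunov; linarith
  have l2 : Tendsto (fun t => perp (X t)) atTop (𝓝 0) :=
    tendsto_of_norm_sq_le one_pos hV fun t => by
      obtain ⟨a1, a2, a3, a4⟩ := hsplit t; unfold lyapunov; linarith
  have l3 : Tendsto (fun t => perp (r t)) atTop (𝓝 0) :=
    tendsto_of_norm_sq_le c2 hV fun t => by
      obtain ⟨a1, a2, a3, a4⟩ := hsplit t; unfold lyapunov; linarith
  have l4 : Tendsto (fun t => average (X t) - Jr (average (r t))) atTop (𝓝 0) :=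
    tendsto_of_norm_sq_le c3 hV fun t => by
      obtain ⟨a1, a2, a3, a4⟩ := hsplit t; unfold lyapunov; linarith
  have m1 : Tendsto (fun t => average (r t)) atTop (𝓝 xs) := by
    simpa using l1.add_const xs
  have m2 : Tendsto (fun t => Jr (average (r t))) atTop (𝓝 xs) := by
    -- The tracking error only ties `x̄` to `𝒥 r̄`; continuity of `𝒥` and `𝒥 x* = x*` identify the
    -- limit.
    have := (hJc.tendsto xs).comp m1
    rwa [hres.fix] at this
  have m3 : Tendsto (fun t => average (X t)) atTop (𝓝 xs) := by
    simpa using l4.add m2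
  have hcons : Continuous (consensus : Profile n → Aug n) := (consensusCLM (n := n)).continuous
  refine ⟨?_, ?_⟩
  · have := l2.add ((hcons.tendsto xs).comp m3)
    simpa [Function.comp_def, perp_add_consensus] using this
  · have := l3.add ((hcons.tendsto xs).comp m1)
    simpa [Function.comp_def, perp_add_consensus] using this

theorem exists_isSolution (hLip : LipschitzWith L_F (pseudoGradient J)) (G : WeightedGraph N)
    (α β c : ℝ) (X₀ r₀ : Aug n) :
    ∃ X r : ℝ → Aug n, IsSolution J G α β c X r ∧ X 0 = X₀ ∧ r 0 = r₀ := by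
  have hF : LipschitzWith L_F (extPseudoGradient J) :=
    LipschitzWith.of_dist_le_mul fun X Y => by
      rw [dist_eq_norm, dist_eq_norm]; exact norm_extPseudoGradient_sub_le hLip X Y
  have hfst : LipschitzWith 1 (Prod.fst : Aug n × Aug n → Aug n) := LipschitzWith.prod_fst
  have hdiff : LipschitzWith (1 + 1) (fun p : Aug n × Aug n => p.1 - p.2) :=
    LipschitzWith.prod_fst.sub LipschitzWith.prod_snd
  have hX := ((((embedOwnCLM (n := n)).lipschitz.comp (hF.comp hfst)).neg).sub
    ((lipschitzWith_smul β).comp hdiff)).sub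
    ((lipschitzWith_smul c).comp ((kronCLM (n := n) G.laplacian).lipschitz.comp hfst))
  have hr := (lipschitzWith_smul (β := Aug n) α).comp hdiff
  obtain ⟨u, hu0, hu⟩ := exists_solution_Ici_of_lipschitz (hX.prodMk hr) (X₀, r₀)
  refine ⟨fun t => (u t).1, fun t => (u t).2, fun t ht => ⟨?_, ?_⟩, by simp [hu0], by simp [hu0]⟩
  · exact (ContinuousLinearMap.snd ℝ (Aug n) (Aug n)).hasFDerivAt.comp_hasDerivWithinAt t (hu t ht)
  · exact (ContinuousLinearMap.fst ℝ (Aug n) (Aug n)).hasFDerivAt.comp_hasDerivWithinAt t (hu t ht)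

end Convergence

end HeavyAnchor

/-- The interval `β ∈ (μ/N, 1/(μNR²))` is read as `(0, ∞)` when `μ = 0`, so its upper bound is
written `μ N R² β < 1`. -/
theorem mainTheorem3 {N : ℕ} (hN : 2 ≤ N) (n : Fin N → ℕ)
    (J : Fin N → Profile n → ℝ) (hJ : RegularCosts J)
    (G : WeightedGraph N) (hG : G.graph.Connected)
    (L_F R : ℝ≥0) (μ : ℝ) (hR : 0 < R) (hμ : 0 ≤ μ)
    (hLip : LipschitzWith L_F (pseudoGradient J))
    (hInv : AntilipschitzWith R (pseudoGradient J))
    (hHypo : Hypomonotone μ (pseudoGradient J))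
    (d α β c LJ κ : ℝ) (hd0 : 0 < d) (hd1 : d < 1)
    (hβ0 : μ / N < β) (hβ1 : μ * N * (R : ℝ) ^ 2 * β < 1)
    (hLJ : LJ = lipJ R μ (1 / (β * N))) (hκ : κ = kappaJ R μ (1 / (β * N)))
    (hα0 : 0 < α)
    (hα1 : α < 4 * d * (1 - d) * (β - μ / N) * (1 - κ)
      / ((1 - d) + d * (LJ + LJ ^ 2)) ^ 2)
    (hc : c * G.lambda2 hN >
      (eta1 N d α β (μ / N) LJ κ + eta2 N d α LJ) / (4 * (Phi d α β (μ / N) LJ κ).det)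
        * (L_F : ℝ) ^ 2 + L_F) :
    ∃ xs : Profile n, IsNashEquilibrium J xs ∧
      ∀ X₀ r₀ : Aug n,
        (∃ X r : ℝ → Aug n, IsSolution J G α β c X r ∧ X 0 = X₀ ∧ r 0 = r₀) ∧
        ∀ X r : ℝ → Aug n, IsSolution J G α β c X r → X 0 = X₀ → r 0 = r₀ →
          Tendsto X atTop (𝓝 (consensus xs)) ∧ Tendsto r atTop (𝓝 (consensus xs)) := by
  have hNpos : (0 : ℝ) < N := by norm_cast; omega
  have hβ : 0 < β := lt_of_le_of_lt (by positivity) hβ0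
  have hR' : (0 : ℝ) < R := by exact_mod_cast hR
  have hl : 0 < 1 / (β * N) := by positivity
  have hμl : μ * (1 / (β * N)) < 1 := by
    rw [mul_one_div, div_lt_one (by positivity)]
    exact (div_lt_iff₀ hNpos).mp hβ0
  have hlR : μ * (R : ℝ) ^ 2 < 1 / (β * N) := by
    rw [lt_div_iff₀ (by positivity)]
    linarith
  obtain ⟨Jr, xs, hres⟩ := exists_isResolvent hLip hInv hHypo hR hl hμl hlR
  rw [← hLJ, ← hκ] at hres
  have hLJ0 : 0 ≤ LJ := hLJ ▸ Real.sqrt_nonneg _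
  have hκ1 : κ < 1 := hκ ▸ kappaJ_lt_one hR' hl hμl hlR
  have hdet := det_Phi_pos hd0 hd1 hα0 hLJ0 hα1
  -- The gain condition forces `c λ₂ > 0`, and `λ₂ ≥ 0`.
  have hc0 : 0 ≤ c := by
    have hη1 : 0 ≤ eta1 N d α β (μ / N) LJ κ := by
      have h1 : 0 ≤ 1 - d := by linarith
      have h2 : 0 ≤ 1 - κ := by linarith
      have h3 : 0 ≤ β - μ / N := by linarith
      unfold eta1; positivity
    have hη2 : 0 ≤ eta2 N d α LJ := by
      have h1 : 0 ≤ 1 + (LJ ^ 2 + LJ - 1) * d := by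
        nlinarith [mul_nonneg hd0.le (sq_nonneg LJ), mul_nonneg hd0.le hLJ0]
      unfold eta2; positivity
    have hpos : 0 < c * G.lambda2 hN := lt_of_le_of_lt (by positivity) hc
    exact (pos_of_mul_pos_left hpos (G.lambda2_nonneg hN)).le
  obtain ⟨δ, hδ, hrate⟩ := exists_lyapunovRate_le hN hLip hHypo hd0 hd1 hα0 hβ hβ0 hLJ0 hκ1 hc0
    hres hdet hc
  exact ⟨xs, isNashEquilibrium_of_pseudoGradient_eq_zero hJ hres.zero, fun X₀ r₀ =>
    ⟨exists_isSolution hLip G α β c X₀ r₀, fun X r hsol _ _ =>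
      tendsto_of_isSolution hN hd0 hd1 hα0 hβ hres hδ hrate hsol⟩⟩
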